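/- Let $d\ge 2$. Let $\varphi:(0,\infty)\to(0,\infty)$ be continuous and increasing (in the wide sense, so every strictly increasing $\varphi$ is included), and suppose $\max\{\delta_\varphi,\delta^\varphi\}<\frac{2}{d+2}$ (written $\varphi\in\mathrm{Ord}(2/(d+2))$), where, with infima taken in $[-\infty,+\infty]$, $$\delta_\varphi=\inf\Big\{\delta\in\mathbb R:\lim_{s\downarrow0}\tfrac{s^{1+\delta}}{\varphi(s)}\text{ exists and is finite}\Big\},\qquad \delta^\varphi=\inf\Big\{\delta\in\mathbb R:\lim_{s\uparrow\infty}\tfrac{s^{1+\delta}}{\varphi(s)}=\infty\Big\}.$$ Put $\ln_\varphi(t)=\int_1^t\frac{ds}{\varphi(s)}$ for $t>0$, $l_\varphi=\inf_{t>0}\ln_\varphi(t)$, $L_\varphi=\sup_{t>0}\ln_\varphi(t)$, and let $\exp_\varphi:\mathbb R\to[0,\infty]$ be the inverse of $\ln_\varphi$ on $(l_\varphi,L_\varphi)$, $0$ on $\tau\le l_\varphi$ and $\infty$ on $\tau\ge L_\varphi$. Then there exist constants $\lambda\in(l_\varphi,L_\varphi)$ and $c>0$ such that $\exp_\varphi(\lambda-c|x|^2)$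 is a probability density on $\mathbb R^d$ with finite second moment, mean $0$ and covariance matrix $I_d$. Fix any such pair $(\lambda,c)$. For $v\in\mathbb R^d$ and $V$ a symmetric positive definite $d\times d$ matrix, let $G_\varphi(v,V)$ be the measure on $\mathbb R^d$ with Lebesgue density $$g_\varphi(v,V)(x)=\exp_\varphi\big(\lambda-c\,\langle x-v,V^{-1}(x-v)\rangle\big)(\det V)^{-1/2},$$ let $G(v,V)$ be the Gaussian measure with mean $v$ and covariance matrix $V$, and let $\mathcal G_\varphi$ and $\mathcal G$ be the sets of all $G_\varphi(v,V)$ and of all $G(v,V)$, respectively. Let $W_2$ be the $L^2$-Wasserstein distance, $W_2(\mu,\nu)=\inf_\pi\big(\int|x-y|^2\,d\pi(x,y)\big)^{1/2}$ over couplings $\pi$ of $\mu$ and $\nu$. A geodesic from $\mu$ to $\nu$ is a curve $(\gamma_t)_{t\in[0,1]}$ of probability measures with finite second moments, with $\gamma_0=\mu$, $\gamma_1=\nu$ and $W_2(\gamma_s,\gamma_t)=|s-t|\,W_2(\mu,\nu)$ for all $s,t\in[0,1]$. Then: 1. Each $G_\varphi(v,V)$ is a probability measure with finite second moment, mean $v$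 and covariance matrix $V$. 2. $\mathcal G_\varphi$ is convex in Wasserstein geometry: any two elements of $\mathcal G_\varphi$ are joined by a geodesic, and every geodesic between them stays in $\mathcal G_\varphi$. 3. The map $G(v,V)\mapsto G_\varphi(v,V)$ is a well-defined bijection from $\mathcal G$ onto $\mathcal G_\varphi$ that preserves $W_2$. 4. For all $v,u\in\mathbb R^d$ and all symmetric positive definite $V,U$, $$W_2(G_\varphi(v,V),G_\varphi(u,U))^2=W_2(G(v,V),G(u,U))^2=|v-u|^2+\operatorname{tr}V+\operatorname{tr}U-2\operatorname{tr}\big(U^{1/2}VU^{1/2}\big)^{1/2}.$$ 5. With $W=U^{1/2}(U^{1/2}VU^{1/2})^{-1/2}U^{1/2}$, $w_t=(1-t)v+tu$ and $W_t=[(1-t)I_d+tW]\,V\,[(1-t)I_d+tW]$, every $W_t$ with $t\in[0,1]$ is symmetric positive definite, and $(G_\varphi(w_t,W_t))_{t\in[0,1]}$ is the unique geodesic from $G_\varphi(v,V)$ to $G_\varphi(u,U)$. -/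

import Mathlib

open MeasureTheory ProbabilityTheory Set Filter Topology Matrix
open scoped ENNReal MatrixOrder

noncomputable section

/-! ### Wasserstein geometry over Euclidean space -/

/-- `ℝ^d` with the Euclidean norm. -/
abbrev Eucl (d : ℕ) : Type := EuclideanSpace ℝ (Fin d)

/-- Probability measures on `ℝ^d` with finite second moment. -/
def InP2 {d : ℕ} (μ : Measure (Eucl d)) : Prop :=
  IsProbabilityMeasure μ ∧ MemLp (fun x : Eucl d => x) 2 μ

/-- `π` is a coupling of `μ` and `ν`. -/
def IsCoupling {d : ℕ} (π : Measure (Eucl d × Eucl d)) (μ ν : Measure (Eucl d)) : Prop :=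
  IsProbabilityMeasure π ∧ π.map Prod.fst = μ ∧ π.map Prod.snd = ν

/-- The `L²`-Wasserstein distance. The infimum is taken in `[0, ∞]`, where no integrability is
needed; it is finite when both measures have finite second moments. -/
def W2 {d : ℕ} (μ ν : Measure (Eucl d)) : ℝ :=
  (⨅ (π : Measure (Eucl d × Eucl d)) (_ : IsCoupling π μ ν),
    (∫⁻ p, edist p.1 p.2 ^ 2 ∂π) ^ (1 / 2 : ℝ)).toReal

/-- `γ` restricted to `[0,1]` is a (constant speed, distance minimizing) Wasserstein geodesic
from `μ` to `ν`. -/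
def IsGeodesic {d : ℕ} (γ : ℝ → Measure (Eucl d)) (μ ν : Measure (Eucl d)) : Prop :=
  (∀ t ∈ Icc (0 : ℝ) 1, InP2 (γ t)) ∧ γ 0 = μ ∧ γ 1 = ν ∧
    ∀ s ∈ Icc (0 : ℝ) 1, ∀ t ∈ Icc (0 : ℝ) 1, W2 (γ s) (γ t) = |s - t| * W2 μ ν

/-- A set of measures is convex in Wasserstein geometry: any two of its points are joined by a
geodesic, and all geodesics between them stay in the set. -/
def GeodesicallyConvex {d : ℕ} (S : Set (Measure (Eucl d))) : Prop :=
  ∀ μ ∈ S, ∀ ν ∈ S, (∃ γ, IsGeodesic γ μ ν) ∧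
    ∀ γ, IsGeodesic γ μ ν → ∀ t ∈ Icc (0 : ℝ) 1, γ t ∈ S

/-! ### The `φ`-logarithm and the `φ`-exponential. Only the values of `φ` on `(0,∞)` matter. -/

/-- `ln_φ(t) = ∫_1^t ds / φ(s)`, for `t > 0`. -/
def lnPhi (φ : ℝ → ℝ) (t : ℝ) : ℝ := ∫ s in (1 : ℝ)..t, 1 / φ s

/-- `l_φ = inf_{t > 0} ln_φ(t) ∈ [-∞, 0)`. -/
def lowerPhi (φ : ℝ → ℝ) : EReal := ⨅ t ∈ Ioi (0 : ℝ), (lnPhi φ t : EReal)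

/-- `L_φ = sup_{t > 0} ln_φ(t) ∈ (0, ∞]`. -/
def upperPhi (φ : ℝ → ℝ) : EReal := ⨆ t ∈ Ioi (0 : ℝ), (lnPhi φ t : EReal)

open Classical in
/-- `exp_φ : ℝ → [0, ∞]`: the inverse of `ln_φ` on `(l_φ, L_φ)`, extended by `0` and `∞`. -/
def expPhi (φ : ℝ → ℝ) (τ : ℝ) : ℝ≥0∞ :=
  if (τ : EReal) ≤ lowerPhi φ then 0
  else if (τ : EReal) < upperPhi φ then
    ENNReal.ofReal (Function.invFunOn (lnPhi φ) (Ioi 0) τ)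
  else ∞

/-- `δ_φ`, the infimum (in `[-∞, ∞]`, so `+∞` for the empty set) of the `δ` for which
`s^(1+δ) / φ(s)` has a (finite) limit as `s ↓ 0`. -/
def deltaZero (φ : ℝ → ℝ) : EReal :=
  sInf ((fun δ : ℝ => (δ : EReal)) ''
    {δ | ∃ l : ℝ, Tendsto (fun s : ℝ => s ^ (1 + δ) / φ s) (𝓝[>] 0) (𝓝 l)})

/-- `δ^φ`, the infimum (in `[-∞, ∞]`) of the `δ` for which `s^(1+δ) / φ(s) → ∞` as `s ↑ ∞`. -/
def deltaInfty (φ : ℝ → ℝ) : EReal :=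
  sInf ((fun δ : ℝ => (δ : EReal)) ''
    {δ | Tendsto (fun s : ℝ => s ^ (1 + δ) / φ s) atTop atTop})

/-- The class `Ord(a)` of increasing, positive, continuous functions on `(0,∞)` with
`max{δ_φ, δ^φ} < a`. Increasing is read in the wide sense, so that strictly increasing functions
are included. -/
def OrdClass (a : ℝ) : Set (ℝ → ℝ) :=
  {φ | MonotoneOn φ (Ioi 0) ∧ (∀ s ∈ Ioi (0 : ℝ), 0 < φ s) ∧ ContinuousOn φ (Ioi 0) ∧
    max (deltaZero φ) (deltaInfty φ) < (a : EReal)}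

/-! ### The family of affine images of one `φ`-exponential profile -/

/-- `μ` is a probability measure with finite second moment, mean `v` and covariance matrix `V`. -/
def HasMeanCov {d : ℕ} (μ : Measure (Eucl d)) (v : Eucl d) (V : Matrix (Fin d) (Fin d) ℝ) :
    Prop :=
  InP2 μ ∧ ∫ x, x ∂μ = v ∧ ∀ i j, ∫ x, (x i - v i) * (x j - v j) ∂μ = V i j

/-- The measure `G_φ(v,V)` with Lebesgue density
`exp_φ(lam - c ⟨x - v, V⁻¹ (x - v)⟩) (det V)^(-1/2)`, for given constants `lam` and `c`. -/
def phiGaussian {d : ℕ} (φ : ℝ → ℝ) (lam c : ℝ) (v : Eucl d) (V : Matrix (Fin d) (Fin d) ℝ) :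
    Measure (Eucl d) :=
  (volume : Measure (Eucl d)).withDensity fun x =>
    expPhi φ (lam - c * ((x - v).ofLp ⬝ᵥ (V⁻¹ *ᵥ (x - v).ofLp))) *
      ENNReal.ofReal ((Real.sqrt V.det)⁻¹)

/-- Constants `(lam, c)` admissible for the identity covariance matrix: `lam ∈ (l_φ, L_φ)`,
`c > 0`, and `exp_φ(lam - c |x|²)` is a probability density on `ℝ^d` with mean `0` and covariance
matrix `I_d`. -/
def IsStandardPair (d : ℕ) (φ : ℝ → ℝ) (lam c : ℝ) : Prop :=
  lowerPhi φ < (lam : EReal) ∧ (lam : EReal) < upperPhi φ ∧ 0 < c ∧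
    HasMeanCov (phiGaussian φ lam c (0 : Eucl d) 1) 0 1

/-- The space `𝒢_φ`. -/
def phiGaussianSpace (d : ℕ) (φ : ℝ → ℝ) (lam c : ℝ) : Set (Measure (Eucl d)) :=
  {μ | ∃ (v : Eucl d) (V : Matrix (Fin d) (Fin d) ℝ), V.PosDef ∧ μ = phiGaussian φ lam c v V}

/-- The space `𝒢` of Gaussian measures on `ℝ^d` (with positive definite covariance matrix). -/
def gaussianSpace (d : ℕ) : Set (Measure (Eucl d)) :=
  {μ | ∃ (v : Eucl d) (V : Matrix (Fin d) (Fin d) ℝ), V.PosDef ∧ μ = multivariateGaussian v V}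

/-! ### The matrix expressions -/

/-- `|v - u|² + tr V + tr U - 2 tr (U^(1/2) V U^(1/2))^(1/2)`. -/
def buresSq {d : ℕ} (v u : Eucl d) (V U : Matrix (Fin d) (Fin d) ℝ) : ℝ :=
  ‖v - u‖ ^ 2 + V.trace + U.trace
    - 2 * (CFC.sqrt (CFC.sqrt U * V * CFC.sqrt U)).trace

/-- `W = U^(1/2) (U^(1/2) V U^(1/2))^(-1/2) U^(1/2)`. -/
def transportMatrix {d : ℕ} (V U : Matrix (Fin d) (Fin d) ℝ) : Matrix (Fin d) (Fin d) ℝ :=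
  CFC.sqrt U * (CFC.sqrt (CFC.sqrt U * V * CFC.sqrt U))⁻¹ * CFC.sqrt U

/-- `w_t = (1-t) v + t u`. -/
def meanInterp {d : ℕ} (v u : Eucl d) (t : ℝ) : Eucl d := (1 - t) • v + t • u

/-- `W_t = [(1-t) I + t W] V [(1-t) I + t W]`. -/
def covInterp {d : ℕ} (V U : Matrix (Fin d) (Fin d) ℝ) (t : ℝ) : Matrix (Fin d) (Fin d) ℝ :=
  ((1 - t) • (1 : Matrix (Fin d) (Fin d) ℝ) + t • transportMatrix V U) * V *
    ((1 - t) • (1 : Matrix (Fin d) (Fin d) ℝ) + t • transportMatrix V U)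

end

/-!
The measure `G_φ(v,V)` is the image of the radial measure `G_φ(0,I)` under `x ↦ v + V^(1/2) x`, and
more generally affine bijections permute the family (`map_affMap_phiGaussian`), just as they permute
the Gaussian measures. The transport matrix `W` of `V` and `U` is positive definite with
`W V W = U`, so `x ↦ u + W (x - v)` carries `G_φ(v,V)` to `G_φ(u,U)`.

An affine map `T` with positive definite linear part `S` is an optimal transport map for every
source measure: there are explicit quadratic functions with
`|x - y|² = f(x) + g(y) + ⟨y - T x, S⁻¹ (y - T x)⟩` (`norm_sub_sq_eq_potentials`), so that the cost
of a coupling exceeds the dual value by the integral of a nonnegative gap, which vanishes on the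
graph of `T`. The cost of `T` depends on means and covariance matrices only, which gives the formula
for `W₂` simultaneously for the Gaussian and for the `φ`-exponential measures.

The displacement interpolations `(1-t) id + t T` are affine of the same kind, and so are the maps
between two of them; hence they form a geodesic. Uniqueness (`eq_map_dispMap_of_W2`) needs neither
gluing nor the existence of optimal couplings. The potentials at time `t` are explicit, and the dual
values of the two halves of a geodesic add up to the dual value of the whole. So nearly optimal
couplings of the source with the midpoint measure have a nearly vanishing gap, and produce
couplings of arbitrarily small cost between the midpoint measure and the interpolation.

For the existence of the constants, the layer-cake formula in the variable `s = exp_φ` expresses mass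
and second moment of `exp_φ(λ - c|x|²)` with `λ = ln_φ(M)` as multiples of `c^(-q) J_q(M)` and
`c^(-q-1) J_(q+1)(M)`, where `q = d/2` and `J_r(M) = ∫₀^M (ln_φ M - ln_φ s)^r ds`
(`excessMoment`). The bound on `δ_φ` makes these integrals finite. Eliminating `c`, the ratio
`J_(q+1) / J_q^(1+1/q)` has to take a prescribed value. It is continuous in `M`, it is unbounded
for `M → 0` because low profiles are spread out (`exists_lt_excessMoment`), and it takes arbitrarily
small values because the bound on `δ^φ` makes high profiles concentrated
(`exists_excessMoment_le`). Orthogonal invariance then yields mean `0` and covariance matrix `I`.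
-/

noncomputable section

/-! ### Couplings and the Wasserstein distance -/

theorem InP2.integrable_id {d : ℕ} {μ : Measure (Eucl d)} (h : InP2 μ) :
    Integrable (fun x => x) μ :=
  have := h.1
  h.2.integrable (by norm_num)

theorem InP2.map {d : ℕ} {μ : Measure (Eucl d)} (h : InP2 μ) {T : Eucl d → Eucl d}
    (hT : Continuous T) (hL : MemLp T 2 μ) : InP2 (μ.map T) := by
  have := h.1
  refine ⟨Measure.isProbabilityMeasure_map hT.aemeasurable, ?_⟩
  rw [memLp_map_measure_iff (by fun_prop) hT.aemeasurable]
  exact hL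

theorem MeasureTheory.MemLp.integrable_inner_of_two {α : Type*} [MeasurableSpace α] {d : ℕ}
    {π : Measure α} {f g : α → Eucl d} (hf : MemLp f 2 π) (hg : MemLp g 2 π) :
    Integrable (fun p => inner ℝ (f p) (g p)) π := by
  refine Integrable.mono' (hf.norm.integrable_mul hg.norm)
    (hf.1.inner hg.1) (Eventually.of_forall fun p => ?_)
  exact norm_inner_le_norm _ _

theorem IsCoupling.memLp_fst {d : ℕ} {π : Measure (Eucl d × Eucl d)} {μ ν : Measure (Eucl d)}
    (h : IsCoupling π μ ν) (hμ : InP2 μ) : MemLp (fun p : Eucl d × Eucl d => p.1) 2 π := by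
  have := hμ.2
  rw [← h.2.1, memLp_map_measure_iff (by fun_prop) (by fun_prop)] at this
  exact this

theorem IsCoupling.memLp_snd {d : ℕ} {π : Measure (Eucl d × Eucl d)} {μ ν : Measure (Eucl d)}
    (h : IsCoupling π μ ν) (hν : InP2 ν) : MemLp (fun p : Eucl d × Eucl d => p.2) 2 π := by
  have := hν.2
  rw [← h.2.2, memLp_map_measure_iff (by fun_prop) (by fun_prop)] at this
  exact this

theorem IsCoupling.integral_fst {d : ℕ} {π : Measure (Eucl d × Eucl d)} {μ ν : Measure (Eucl d)}
    (h : IsCoupling π μ ν) {f : Eucl d → ℝ} (hf : Continuous f) :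
    ∫ p, f p.1 ∂π = ∫ x, f x ∂μ := by
  rw [← h.2.1, integral_map (by fun_prop) hf.aestronglyMeasurable]

theorem IsCoupling.integral_snd {d : ℕ} {π : Measure (Eucl d × Eucl d)} {μ ν : Measure (Eucl d)}
    (h : IsCoupling π μ ν) {f : Eucl d → ℝ} (hf : Continuous f) :
    ∫ p, f p.2 ∂π = ∫ x, f x ∂ν := by
  rw [← h.2.2, integral_map (by fun_prop) hf.aestronglyMeasurable]

theorem IsCoupling.integrable_fst {d : ℕ} {π : Measure (Eucl d × Eucl d)} {μ ν : Measure (Eucl d)}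
    (h : IsCoupling π μ ν) {f : Eucl d → ℝ} (hf : Continuous f) (hi : Integrable f μ) :
    Integrable (fun p => f p.1) π := by
  rw [← h.2.1, integrable_map_measure hf.aestronglyMeasurable (by fun_prop)] at hi
  exact hi

theorem IsCoupling.integrable_snd {d : ℕ} {π : Measure (Eucl d × Eucl d)} {μ ν : Measure (Eucl d)}
    (h : IsCoupling π μ ν) {f : Eucl d → ℝ} (hf : Continuous f) (hi : Integrable f ν) :
    Integrable (fun p => f p.2) π := by
  rw [← h.2.2, integrable_map_measure hf.aestronglyMeasurable (by fun_prop)] at hi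
  exact hi

theorem IsCoupling.memLp_sub {d : ℕ} {π : Measure (Eucl d × Eucl d)} {μ ν : Measure (Eucl d)}
    (h : IsCoupling π μ ν) (hμ : InP2 μ) (hν : InP2 ν) :
    MemLp (fun p : Eucl d × Eucl d => p.1 - p.2) 2 π :=
  (h.memLp_fst hμ).sub (h.memLp_snd hν)

theorem IsCoupling.integrable_cost {d : ℕ} {π : Measure (Eucl d × Eucl d)} {μ ν : Measure (Eucl d)}
    (h : IsCoupling π μ ν) (hμ : InP2 μ) (hν : InP2 ν) :
    Integrable (fun p : Eucl d × Eucl d => ‖p.1 - p.2‖ ^ 2) π := by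
  have := h.1
  exact (h.memLp_sub hμ hν).integrable_norm_pow (p := 2) (by norm_num)

theorem IsCoupling.lintegral_cost {d : ℕ} {π : Measure (Eucl d × Eucl d)} {μ ν : Measure (Eucl d)}
    (h : IsCoupling π μ ν) (hμ : InP2 μ) (hν : InP2 ν) :
    ∫⁻ p, edist p.1 p.2 ^ 2 ∂π = ENNReal.ofReal (∫ p, ‖p.1 - p.2‖ ^ 2 ∂π) := by
  rw [ofReal_integral_eq_lintegral_ofReal (h.integrable_cost hμ hν)
    (Eventually.of_forall fun p => by positivity)]
  refine lintegral_congr fun p => ?_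
  rw [edist_dist, dist_eq_norm, ENNReal.ofReal_pow (norm_nonneg _)]

theorem isCoupling_prod {d : ℕ} {μ ν : Measure (Eucl d)} (hμ : InP2 μ) (hν : InP2 ν) :
    IsCoupling (μ.prod ν) μ ν := by
  have := hμ.1
  have := hν.1
  exact ⟨inferInstance, by simp, by simp⟩

theorem isCoupling_map {d : ℕ} {α : Type*} [MeasurableSpace α] {ρ : Measure α}
    [IsProbabilityMeasure ρ] {f g : α → Eucl d} (hf : Measurable f) (hg : Measurable g) :
    IsCoupling (ρ.map fun p => (f p, g p)) (ρ.map f) (ρ.map g) := by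
  refine ⟨Measure.isProbabilityMeasure_map (hf.prodMk hg).aemeasurable, ?_, ?_⟩
  · rw [Measure.map_map measurable_fst (hf.prodMk hg)]; rfl
  · rw [Measure.map_map measurable_snd (hf.prodMk hg)]; rfl

/-- On measures with finite second moment, `W2 ^ 2` is the infimum of the (real) quadratic costs;
the set of costs is nonempty because of the product coupling. -/
theorem W2_sq_isGLB {d : ℕ} {μ ν : Measure (Eucl d)} (hμ : InP2 μ) (hν : InP2 ν) :
    IsGLB {r | ∃ π, IsCoupling π μ ν ∧ r = ∫ p, ‖p.1 - p.2‖ ^ 2 ∂π} (W2 μ ν ^ 2) := by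
  have hle : ∀ π, IsCoupling π μ ν →
      (⨅ (π : Measure (Eucl d × Eucl d)) (_ : IsCoupling π μ ν),
        (∫⁻ p, edist p.1 p.2 ^ 2 ∂π) ^ (1 / 2 : ℝ)) ≤
        ENNReal.ofReal (Real.sqrt (∫ p, ‖p.1 - p.2‖ ^ 2 ∂π)) := by
    intro π hπ
    refine (iInf₂_le π hπ).trans_eq ?_
    rw [hπ.lintegral_cost hμ hν, ENNReal.ofReal_rpow_of_nonneg (by positivity) (by norm_num),
      Real.sqrt_eq_rpow]
  constructor
  · rintro r ⟨π, hπ, rfl⟩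
    have h1 : W2 μ ν ≤ Real.sqrt (∫ p, ‖p.1 - p.2‖ ^ 2 ∂π) :=
      ENNReal.toReal_le_of_le_ofReal (Real.sqrt_nonneg _) (hle π hπ)
    calc W2 μ ν ^ 2 ≤ Real.sqrt (∫ p, ‖p.1 - p.2‖ ^ 2 ∂π) ^ 2 :=
          pow_le_pow_left₀ ENNReal.toReal_nonneg h1 2
      _ = _ := Real.sq_sqrt (by positivity)
  · intro b hb
    rcases le_or_gt b 0 with hb0 | hb0
    · exact hb0.trans (sq_nonneg _)
    have h2 : ENNReal.ofReal (Real.sqrt b) ≤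
        ⨅ (π : Measure (Eucl d × Eucl d)) (_ : IsCoupling π μ ν),
        (∫⁻ p, edist p.1 p.2 ^ 2 ∂π) ^ (1 / 2 : ℝ) := by
      refine le_iInf₂ fun π hπ => ?_
      rw [hπ.lintegral_cost hμ hν, ENNReal.ofReal_rpow_of_nonneg (by positivity) (by norm_num),
        ← Real.sqrt_eq_rpow]
      exact ENNReal.ofReal_le_ofReal (Real.sqrt_le_sqrt (hb ⟨π, hπ, rfl⟩))
    have h3 : Real.sqrt b ≤ W2 μ ν := by
      refine (ENNReal.ofReal_le_iff_le_toReal ?_).1 h2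
      exact ne_top_of_le_ne_top ENNReal.ofReal_ne_top (hle _ (isCoupling_prod hμ hν))
    calc b = Real.sqrt b ^ 2 := (Real.sq_sqrt hb0.le).symm
      _ ≤ _ := pow_le_pow_left₀ (Real.sqrt_nonneg _) h3 2

theorem W2_nonneg {d : ℕ} (μ ν : Measure (Eucl d)) : 0 ≤ W2 μ ν := ENNReal.toReal_nonneg

theorem W2_sq_le {d : ℕ} {μ ν : Measure (Eucl d)} (hμ : InP2 μ) (hν : InP2 ν)
    {π : Measure (Eucl d × Eucl d)} (hπ : IsCoupling π μ ν) :
    W2 μ ν ^ 2 ≤ ∫ p, ‖p.1 - p.2‖ ^ 2 ∂π :=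
  (W2_sq_isGLB hμ hν).1 ⟨π, hπ, rfl⟩

theorem exists_coupling_lt {d : ℕ} {μ ν : Measure (Eucl d)} (hμ : InP2 μ) (hν : InP2 ν)
    {ε : ℝ} (hε : 0 < ε) :
    ∃ π, IsCoupling π μ ν ∧ ∫ p, ‖p.1 - p.2‖ ^ 2 ∂π < W2 μ ν ^ 2 + ε := by
  obtain ⟨r, ⟨π, hπ, rfl⟩, -, h⟩ := (W2_sq_isGLB hμ hν).exists_between
    (show W2 μ ν ^ 2 < W2 μ ν ^ 2 + ε by linarith)
  exact ⟨π, hπ, h⟩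

/-- Two measures with couplings of arbitrarily small quadratic cost coincide: their characteristic
functions do, since `x ↦ exp (i ⟨x, t⟩)` is Lipschitz. -/
theorem eq_of_forall_exists_coupling_lt {d : ℕ} {μ ν : Measure (Eucl d)} (hμ : InP2 μ)
    (hν : InP2 ν)
    (h : ∀ ε > 0, ∃ π, IsCoupling π μ ν ∧ ∫ p, ‖p.1 - p.2‖ ^ 2 ∂π < ε) : μ = ν := by
  have := hμ.1
  have := hν.1
  refine Measure.ext_of_charFun (funext fun t => ?_)
  have key : ∀ ε > 0, ‖charFun μ t - charFun ν t‖ ≤ ‖t‖ * (ε + ε) := by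
    intro ε hε
    obtain ⟨π, hπ, hlt⟩ := h (ε ^ 2) (by positivity)
    have := hπ.1
    have hc : Continuous fun x : Eucl d => Complex.exp (inner ℝ x t * Complex.I) := by fun_prop
    have hb : ∀ x : Eucl d, ‖Complex.exp (inner ℝ x t * Complex.I)‖ ≤ 1 := fun x => by
      rw [Complex.norm_exp_ofReal_mul_I]
    have h1 : charFun μ t = ∫ p, Complex.exp (inner ℝ p.1 t * Complex.I) ∂π := by
      rw [charFun_apply, ← hπ.2.1, integral_map (by fun_prop) hc.aestronglyMeasurable]
    have h2 : charFun ν t = ∫ p, Complex.exp (inner ℝ p.2 t * Complex.I) ∂π := by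
      rw [charFun_apply, ← hπ.2.2, integral_map (by fun_prop) hc.aestronglyMeasurable]
    have i1 : Integrable (fun p : Eucl d × Eucl d => Complex.exp (inner ℝ p.1 t * Complex.I)) π :=
      Integrable.of_bound (hc.comp continuous_fst).aestronglyMeasurable 1
        (Eventually.of_forall fun p => hb p.1)
    have i2 : Integrable (fun p : Eucl d × Eucl d => Complex.exp (inner ℝ p.2 t * Complex.I)) π :=
      Integrable.of_bound (hc.comp continuous_snd).aestronglyMeasurable 1
        (Eventually.of_forall fun p => hb p.2)
    rw [h1, h2, ← integral_sub i1 i2]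
    have hpt : ∀ p : Eucl d × Eucl d, ‖Complex.exp (inner ℝ p.1 t * Complex.I) -
        Complex.exp (inner ℝ p.2 t * Complex.I)‖ ≤ ‖t‖ * (ε + ‖p.1 - p.2‖ ^ 2 / ε) := by
      intro p
      have e1 : Complex.exp (inner ℝ p.1 t * Complex.I) -
          Complex.exp (inner ℝ p.2 t * Complex.I) =
          Complex.exp (inner ℝ p.2 t * Complex.I) *
            (Complex.exp (Complex.I * ((inner ℝ (p.1 - p.2) t : ℝ) : ℂ)) - 1) := by
        rw [mul_sub, ← Complex.exp_add, mul_one, inner_sub_left]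
        congr 2
        push_cast
        ring
      rw [e1, norm_mul, Complex.norm_exp_ofReal_mul_I, one_mul]
      refine Real.norm_exp_I_mul_ofReal_sub_one_le.trans ((norm_inner_le_norm _ _).trans ?_)
      rw [mul_comm]
      refine mul_le_mul_of_nonneg_left ?_ (norm_nonneg _)
      rw [← sub_nonneg]
      have : ε + ‖p.1 - p.2‖ ^ 2 / ε - ‖p.1 - p.2‖ =
        ((‖p.1 - p.2‖ - ε / 2) ^ 2 + 3 / 4 * ε ^ 2) / ε := by field_simp; ring
      rw [this]; positivity
    have hi := hπ.integrable_cost hμ hν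
    calc _ ≤ ∫ p, ‖t‖ * (ε + ‖p.1 - p.2‖ ^ 2 / ε) ∂π :=
          norm_integral_le_of_norm_le
            (((integrable_const ε).add (hi.div_const ε)).const_mul _) (Eventually.of_forall hpt)
      _ = ‖t‖ * (ε + (∫ p, ‖p.1 - p.2‖ ^ 2 ∂π) / ε) := by
          rw [integral_const_mul, integral_add (integrable_const ε) (hi.div_const ε),
            integral_div]
          simp
      _ ≤ ‖t‖ * (ε + ε) := by
          refine mul_le_mul_of_nonneg_left (add_le_add le_rfl ?_) (norm_nonneg _)
          rw [div_le_iff₀ hε, ← sq]; exact hlt.le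
  have h0 : ‖charFun μ t - charFun ν t‖ ≤ 0 := by
    have hlim : Tendsto (fun ε : ℝ => ‖t‖ * (ε + ε)) (𝓝[>] 0) (𝓝 0) := by
      have : Tendsto (fun ε : ℝ => ‖t‖ * (ε + ε)) (𝓝 0) (𝓝 (‖t‖ * (0 + 0))) := by
        apply Continuous.tendsto; fun_prop
      simp only [add_zero, mul_zero] at this
      exact this.mono_left nhdsWithin_le_nhds
    exact ge_of_tendsto hlim (eventually_nhdsWithin_of_forall key)
  exact sub_eq_zero.1 (norm_le_zero_iff.1 h0)

/-! ### Affine maps with positive definite linear part -/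

/-- The operator on `ℝ^d` given by a matrix. -/
abbrev matCLM {d : ℕ} (S : Matrix (Fin d) (Fin d) ℝ) : Eucl d →L[ℝ] Eucl d :=
  toEuclideanCLM (𝕜 := ℝ) S

/-- The affine map with linear part `S` that sends `v` to `u`. -/
def affMap {d : ℕ} (v u : Eucl d) (S : Matrix (Fin d) (Fin d) ℝ) (x : Eucl d) : Eucl d :=
  u + matCLM S (x - v)

/-- The part of the squared distance cost that depends on the source point only, in the dual
problem solved by `affMap v u S`. -/
def sourcePotential {d : ℕ} (v u : Eucl d) (S : Matrix (Fin d) (Fin d) ℝ) (x : Eucl d) : ℝ :=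
  ‖x‖ ^ 2 - 2 * inner ℝ x u - inner ℝ (x - v) (matCLM S (x - v))

/-- The part of the squared distance cost that depends on the target point only, in the dual
problem solved by `affMap v u S`. -/
def targetPotential {d : ℕ} (v u : Eucl d) (S : Matrix (Fin d) (Fin d) ℝ) (y : Eucl d) : ℝ :=
  ‖y‖ ^ 2 - 2 * inner ℝ v y + 2 * inner ℝ v u - inner ℝ (y - u) (matCLM S⁻¹ (y - u))

/-- The slack in the dual constraint: it measures how far `y` is from `affMap v u S x`. -/
def dualGap {d : ℕ} (v u : Eucl d) (S : Matrix (Fin d) (Fin d) ℝ) (x y : Eucl d) : ℝ :=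
  inner ℝ (y - affMap v u S x) (matCLM S⁻¹ (y - affMap v u S x))

section

variable {d : ℕ} {v u : Eucl d} {S : Matrix (Fin d) (Fin d) ℝ} {μ : Measure (Eucl d)}

theorem matCLM_mul_apply (A B : Matrix (Fin d) (Fin d) ℝ) (x : Eucl d) :
    matCLM (A * B) x = matCLM A (matCLM B x) := by
  rw [matCLM, map_mul]; rfl

theorem matCLM_one_apply (x : Eucl d) : matCLM (1 : Matrix (Fin d) (Fin d) ℝ) x = x := by
  rw [matCLM, map_one]; rfl

theorem Matrix.IsHermitian.inner_matCLM_left (hS : S.IsHermitian) (x y : Eucl d) :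
    inner ℝ (matCLM S x) y = inner ℝ x (matCLM S y) := by
  have h : star (matCLM S) = matCLM S := by
    rw [matCLM, ← map_star]; exact congrArg _ hS
  conv_lhs => rw [← h]
  exact ContinuousLinearMap.adjoint_inner_left _ _ _

theorem Matrix.PosDef.isUnit_det' (hS : S.PosDef) : IsUnit S.det :=
  (Matrix.isUnit_iff_isUnit_det S).1 hS.isUnit

theorem Matrix.PosDef.matCLM_inv_apply (hS : S.PosDef) (x : Eucl d) :
    matCLM S⁻¹ (matCLM S x) = x := by
  rw [← matCLM_mul_apply, Matrix.nonsing_inv_mul _ hS.isUnit_det', matCLM_one_apply]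

theorem Matrix.PosDef.matCLM_apply_inv (hS : S.PosDef) (x : Eucl d) :
    matCLM S (matCLM S⁻¹ x) = x := by
  rw [← matCLM_mul_apply, Matrix.mul_nonsing_inv _ hS.isUnit_det', matCLM_one_apply]

theorem Matrix.PosDef.inner_matCLM_nonneg (hS : S.PosDef) (x : Eucl d) :
    0 ≤ inner ℝ x (matCLM S x) := by
  rw [inner_toEuclideanCLM]
  exact hS.posSemidef.dotProduct_mulVec_nonneg _

theorem Matrix.PosDef.norm_sq_le_inner_inv (hS : S.PosDef) :
    ∃ C : ℝ, 0 ≤ C ∧ ∀ x : Eucl d, ‖x‖ ^ 2 ≤ C * inner ℝ x (matCLM S⁻¹ x) := by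
  have hR : IsStrictlyPositive (CFC.sqrt S) :=
    IsStrictlyPositive.sqrt S (isStrictlyPositive_iff_posDef.2 hS)
  have hR' : (CFC.sqrt S).PosDef := isStrictlyPositive_iff_posDef.1 hR
  refine ⟨‖matCLM (CFC.sqrt S)‖ ^ 2, by positivity, fun x => ?_⟩
  have h1 : S⁻¹ = (CFC.sqrt S)⁻¹ * (CFC.sqrt S)⁻¹ := by
    rw [← Matrix.mul_inv_rev, CFC.sqrt_mul_sqrt_self S hS.posSemidef.nonneg]
  have h2 : inner ℝ x (matCLM S⁻¹ x) = ‖matCLM (CFC.sqrt S)⁻¹ x‖ ^ 2 := by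
    rw [h1, matCLM_mul_apply, ← hR'.inv.isHermitian.inner_matCLM_left, real_inner_self_eq_norm_sq]
  rw [h2, ← mul_pow]
  refine pow_le_pow_left₀ (norm_nonneg _) ?_ 2
  calc ‖x‖ = ‖matCLM (CFC.sqrt S) (matCLM (CFC.sqrt S)⁻¹ x)‖ := by rw [hR'.matCLM_apply_inv]
    _ ≤ _ := ContinuousLinearMap.le_opNorm _ _

theorem continuous_affMap (v u : Eucl d) (S : Matrix (Fin d) (Fin d) ℝ) :
    Continuous (affMap v u S) := by
  unfold affMap; fun_prop

theorem InP2.memLp_affMap (h : InP2 μ) (v u : Eucl d) (S : Matrix (Fin d) (Fin d) ℝ) :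
    MemLp (affMap v u S) 2 μ := by
  have := h.1
  exact (memLp_const u).add ((matCLM S).comp_memLp' (h.2.sub (memLp_const v)))

theorem InP2.map_affMap (h : InP2 μ) (v u : Eucl d) (S : Matrix (Fin d) (Fin d) ℝ) :
    InP2 (μ.map (affMap v u S)) :=
  h.map (continuous_affMap v u S) (h.memLp_affMap v u S)

/-! ### Optimality of affine maps, by quadratic duality -/

theorem norm_sub_sq_eq_potentials (hS : S.PosDef) (x y : Eucl d) :
    ‖x - y‖ ^ 2 = sourcePotential v u S x + targetPotential v u S y + dualGap v u S x y := by
  have e1 : y - affMap v u S x = (y - u) - matCLM S (x - v) := by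
    unfold affMap; abel
  have e2 : inner ℝ (matCLM S (x - v)) (matCLM S⁻¹ (y - u)) = inner ℝ (x - v) (y - u) := by
    rw [hS.isHermitian.inner_matCLM_left, hS.matCLM_apply_inv]
  have e3 : inner ℝ (matCLM S (x - v)) (x - v) = inner ℝ (x - v) (matCLM S (x - v)) :=
    real_inner_comm _ _
  have e4 : dualGap v u S x y = inner ℝ (y - u) (matCLM S⁻¹ (y - u)) -
      2 * inner ℝ (x - v) (y - u) + inner ℝ (x - v) (matCLM S (x - v)) := by
    unfold dualGap
    rw [e1]
    generalize x - v = a at *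
    rw [map_sub, hS.matCLM_inv_apply, inner_sub_left, inner_sub_right, inner_sub_right, e2, e3,
      real_inner_comm a (y - u)]
    ring
  have e5 : inner ℝ (x - v) (y - u) =
      inner ℝ x y - inner ℝ x u - inner ℝ v y + (inner ℝ v u : ℝ) := by
    rw [inner_sub_left, inner_sub_right, inner_sub_right]; ring
  rw [e4, sourcePotential, targetPotential, e5, norm_sub_sq_real]
  ring

theorem dualGap_nonneg (hS : S.PosDef) (x y : Eucl d) : 0 ≤ dualGap v u S x y :=
  hS.inv.inner_matCLM_nonneg _

theorem dualGap_affMap (x : Eucl d) : dualGap v u S x (affMap v u S x) = 0 := by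
  simp [dualGap]

theorem continuous_sourcePotential : Continuous (sourcePotential v u S) := by
  unfold sourcePotential; fun_prop

theorem continuous_targetPotential : Continuous (targetPotential v u S) := by
  unfold targetPotential; fun_prop

theorem InP2.integrable_sourcePotential (h : InP2 μ) : Integrable (sourcePotential v u S) μ := by
  have := h.1
  have h1 : MemLp (fun x : Eucl d => x - v) 2 μ := h.2.sub (memLp_const v)
  exact ((h.2.integrable_norm_pow (p := 2) (by norm_num)).sub
    ((h.2.integrable_inner_of_two (memLp_const u)).const_mul 2)).sub
    (h1.integrable_inner_of_two ((matCLM S).comp_memLp' h1))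

theorem InP2.integrable_targetPotential (h : InP2 μ) : Integrable (targetPotential v u S) μ := by
  have := h.1
  have h1 : MemLp (fun x : Eucl d => x - u) 2 μ := h.2.sub (memLp_const u)
  exact (((h.2.integrable_norm_pow (p := 2) (by norm_num)).sub
    (((memLp_const v).integrable_inner_of_two h.2).const_mul 2)).add (integrable_const _)).sub
    (h1.integrable_inner_of_two ((matCLM S⁻¹).comp_memLp' h1))

theorem IsCoupling.integrable_dualGap {π : Measure (Eucl d × Eucl d)} {ν : Measure (Eucl d)}
    (hπ : IsCoupling π μ ν) (hμ : InP2 μ) (hν : InP2 ν) :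
    Integrable (fun p => dualGap v u S p.1 p.2) π := by
  have := hπ.1
  have h1 : MemLp (fun p : Eucl d × Eucl d => p.2 - affMap v u S p.1) 2 π :=
    (hπ.memLp_snd hν).sub ((memLp_const u).add
      ((matCLM S).comp_memLp' ((hπ.memLp_fst hμ).sub (memLp_const v))))
  exact h1.integrable_inner_of_two ((matCLM S⁻¹).comp_memLp' h1)

theorem IsCoupling.integral_cost_eq {π : Measure (Eucl d × Eucl d)} {ν : Measure (Eucl d)}
    (hπ : IsCoupling π μ ν) (hμ : InP2 μ) (hν : InP2 ν) (hS : S.PosDef) (v u : Eucl d) :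
    ∫ p, ‖p.1 - p.2‖ ^ 2 ∂π = ∫ x, sourcePotential v u S x ∂μ + ∫ y, targetPotential v u S y ∂ν +
      ∫ p, dualGap v u S p.1 p.2 ∂π := by
  have i1 := hπ.integrable_fst continuous_sourcePotential
    (hμ.integrable_sourcePotential (v := v) (u := u) (S := S))
  have i2 := hπ.integrable_snd continuous_targetPotential
    (hν.integrable_targetPotential (v := v) (u := u) (S := S))
  rw [← hπ.integral_fst continuous_sourcePotential, ← hπ.integral_snd continuous_targetPotential,
    ← integral_add i1 i2,
    ← integral_add (by exact i1.add i2) (hπ.integrable_dualGap hμ hν)]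
  exact integral_congr_ae (Eventually.of_forall fun p => norm_sub_sq_eq_potentials hS _ _)

theorem integral_cost_affMap_eq (hμ : InP2 μ) (hS : S.PosDef) (v u : Eucl d) :
    ∫ x, ‖x - affMap v u S x‖ ^ 2 ∂μ = ∫ x, sourcePotential v u S x ∂μ +
      ∫ y, targetPotential v u S y ∂(μ.map (affMap v u S)) := by
  have := hμ.1
  have hT := continuous_affMap v u S
  have hπ : IsCoupling (μ.map fun x => (x, affMap v u S x)) μ (μ.map (affMap v u S)) := by
    simpa using isCoupling_map (ρ := μ) measurable_id hT.measurable
  have h := hπ.integral_cost_eq hμ (hμ.map_affMap v u S) hS v u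
  have hc : Continuous fun p : Eucl d × Eucl d => dualGap v u S p.1 p.2 := by
    unfold dualGap affMap; fun_prop
  rw [integral_map (by fun_prop) (by fun_prop),
    integral_map (μ := μ) (f := fun p : Eucl d × Eucl d => dualGap v u S p.1 p.2)
      (by fun_prop) hc.aestronglyMeasurable] at h
  simpa [dualGap_affMap] using h

/-- An affine map with positive definite linear part is an optimal transport map. -/
theorem W2_sq_map_affMap (hμ : InP2 μ) (hS : S.PosDef) (v u : Eucl d) :
    W2 μ (μ.map (affMap v u S)) ^ 2 = ∫ x, ‖x - affMap v u S x‖ ^ 2 ∂μ := by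
  have := hμ.1
  have hT := continuous_affMap v u S
  have hν := hμ.map_affMap v u S
  apply le_antisymm
  · have hπ : IsCoupling (μ.map fun x => (x, affMap v u S x)) μ (μ.map (affMap v u S)) := by
      simpa using isCoupling_map (ρ := μ) measurable_id hT.measurable
    have h := W2_sq_le hμ hν hπ
    rwa [integral_map (by fun_prop) (by fun_prop)] at h
  · refine (W2_sq_isGLB hμ hν).2 ?_
    rintro r ⟨π, hπ, rfl⟩
    rw [hπ.integral_cost_eq hμ hν hS v u, integral_cost_affMap_eq hμ hS]
    exact le_add_of_nonneg_right (integral_nonneg fun p => dualGap_nonneg hS _ _)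

/-! ### Displacement interpolation along an affine map -/

/-- The linear part of the displacement interpolation at time `t` towards an affine map with
linear part `S`. -/
def dispMatrix (S : Matrix (Fin d) (Fin d) ℝ) (t : ℝ) : Matrix (Fin d) (Fin d) ℝ :=
  (1 - t) • (1 : Matrix (Fin d) (Fin d) ℝ) + t • S

theorem posDef_dispMatrix (hS : S.PosDef) {t : ℝ} (ht : t ∈ Icc (0 : ℝ) 1) :
    (dispMatrix S t).PosDef := by
  unfold dispMatrix
  rcases ht.1.eq_or_lt with rfl | h0
  · simpa using PosDef.one
  · exact PosDef.posSemidef_add (PosDef.one.posSemidef.smul (sub_nonneg.2 ht.2)) (hS.smul h0)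

/-- The displacement interpolation at time `t` towards `affMap v u S`. -/
def dispMap (v u : Eucl d) (S : Matrix (Fin d) (Fin d) ℝ) (t : ℝ) : Eucl d → Eucl d :=
  affMap v (meanInterp v u t) (dispMatrix S t)

theorem continuous_dispMap (v u : Eucl d) (S : Matrix (Fin d) (Fin d) ℝ) (t : ℝ) :
    Continuous (dispMap v u S t) :=
  continuous_affMap _ _ _

theorem dispMap_apply (v u : Eucl d) (S : Matrix (Fin d) (Fin d) ℝ) (t : ℝ) (x : Eucl d) :
    dispMap v u S t x = (1 - t) • x + t • affMap v u S x := by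
  have : matCLM (dispMatrix S t) (x - v) = (1 - t) • (x - v) + t • matCLM S (x - v) := by
    simp only [matCLM, dispMatrix, map_add, map_smul, map_one]; rfl
  rw [dispMap, affMap, this, affMap, meanInterp]
  module

theorem dispMatrix_mul_comm (S : Matrix (Fin d) (Fin d) ℝ) (s t : ℝ) :
    dispMatrix S s * dispMatrix S t = dispMatrix S t * dispMatrix S s := by
  simp only [dispMatrix, add_mul, mul_add, smul_mul_smul_comm, one_mul, mul_one, mul_comm]
  abel

/-- The maps from time `s` to time `t` are again affine with positive definite linear part. -/
theorem posDef_dispMatrix_mul_inv (hS : S.PosDef) {s t : ℝ} (hs : s ∈ Icc (0 : ℝ) 1)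
    (ht : t ∈ Icc (0 : ℝ) 1) : (dispMatrix S t * (dispMatrix S s)⁻¹).PosDef := by
  have hA := posDef_dispMatrix hS hs
  have hB := posDef_dispMatrix hS ht
  set A := dispMatrix S s
  set B := dispMatrix S t
  have h : A * B = B * A := dispMatrix_mul_comm S s t
  have hcomm : Commute B A⁻¹ := by
    calc B * A⁻¹ = A⁻¹ * (A * B) * A⁻¹ := by
          rw [← mul_assoc, Matrix.nonsing_inv_mul _ hA.isUnit_det', one_mul]
      _ = A⁻¹ * B := by
          rw [h, mul_assoc, mul_assoc, Matrix.mul_nonsing_inv _ hA.isUnit_det', mul_one]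
  exact isStrictlyPositive_iff_posDef.1 ((IsStrictlyPositive.commute_iff
    (isStrictlyPositive_iff_posDef.2 hB) (isStrictlyPositive_iff_posDef.2 hA.inv)).1 hcomm)

theorem dispMap_dispMap (hS : S.PosDef) {s : ℝ} (hs : s ∈ Icc (0 : ℝ) 1) (t : ℝ) (x : Eucl d) :
    affMap (meanInterp v u s) (meanInterp v u t) (dispMatrix S t * (dispMatrix S s)⁻¹)
      (dispMap v u S s x) = dispMap v u S t x := by
  simp only [dispMap, affMap, add_sub_cancel_left, matCLM_mul_apply,
    (posDef_dispMatrix hS hs).matCLM_inv_apply]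

theorem W2_map_dispMap (hμ : InP2 μ) (hS : S.PosDef) (v u : Eucl d) {s t : ℝ}
    (hs : s ∈ Icc (0 : ℝ) 1) (ht : t ∈ Icc (0 : ℝ) 1) :
    W2 (μ.map (dispMap v u S s)) (μ.map (dispMap v u S t)) =
      |s - t| * W2 μ (μ.map (affMap v u S)) := by
  have hγ : InP2 (μ.map (dispMap v u S s)) := hμ.map_affMap _ _ _
  have hP := posDef_dispMatrix_mul_inv hS hs ht
  have h1 : μ.map (dispMap v u S t) = (μ.map (dispMap v u S s)).map
      (affMap (meanInterp v u s) (meanInterp v u t) (dispMatrix S t * (dispMatrix S s)⁻¹)) := by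
    rw [Measure.map_map (continuous_affMap _ _ _).measurable (continuous_dispMap _ _ _ _).measurable]
    congr 1
    exact funext fun x => (dispMap_dispMap hS hs t x).symm
  have hc := continuous_affMap (meanInterp v u s) (meanInterp v u t)
    (dispMatrix S t * (dispMatrix S s)⁻¹)
  have h2 : W2 (μ.map (dispMap v u S s)) (μ.map (dispMap v u S t)) ^ 2 =
      (|s - t| * W2 μ (μ.map (affMap v u S))) ^ 2 := by
    rw [h1, W2_sq_map_affMap hγ hP, mul_pow, W2_sq_map_affMap hμ hS, sq_abs,
      integral_map (continuous_dispMap _ _ _ _).aemeasurable (by fun_prop), ← integral_const_mul]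
    refine integral_congr_ae (Eventually.of_forall fun x => ?_)
    have : dispMap v u S s x - dispMap v u S t x = (t - s) • (x - affMap v u S x) := by
      rw [dispMap_apply, dispMap_apply]; module
    simp only [dispMap_dispMap hS hs t x]
    rw [this, norm_smul, mul_pow, Real.norm_eq_abs, sq_abs]
    ring
  exact (pow_left_inj₀ (W2_nonneg _ _) (mul_nonneg (abs_nonneg _) (W2_nonneg _ _)) two_ne_zero).1 h2

theorem isGeodesic_map_dispMap (hμ : InP2 μ) (hS : S.PosDef) (v u : Eucl d) :
    IsGeodesic (fun t => μ.map (dispMap v u S t)) μ (μ.map (affMap v u S)) := by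
  refine ⟨fun t _ => hμ.map_affMap _ _ _, ?_, ?_, fun s hs t ht => W2_map_dispMap hμ hS v u hs ht⟩
  · have : dispMap v u S 0 = id := funext fun x => by simp [dispMap_apply]
    simp [this]
  · have : dispMap v u S 1 = affMap v u S := funext fun x => by simp [dispMap_apply]
    simp [this]

/-- Up to a constant, the source potential of the interpolation is proportional to the source
potential of the endpoint map. -/
theorem sourcePotential_dispMatrix (v u : Eucl d) (S : Matrix (Fin d) (Fin d) ℝ) (t : ℝ)
    (x : Eucl d) :
    sourcePotential v (meanInterp v u t) (dispMatrix S t) x =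
      t * sourcePotential v u S x - (1 - t) * ‖v‖ ^ 2 := by
  have : matCLM (dispMatrix S t) (x - v) = (1 - t) • (x - v) + t • matCLM S (x - v) := by
    simp only [matCLM, dispMatrix, map_add, map_smul, map_one]; rfl
  simp only [sourcePotential, this, meanInterp, inner_add_right, inner_smul_right,
    real_inner_self_eq_norm_sq, norm_sub_sq_real]
  ring

theorem norm_sub_sq_le_div_add_div {t : ℝ} (h0 : 0 < t) (h1 : t < 1) (x y z : Eucl d) :
    ‖x - y‖ ^ 2 ≤ ‖x - z‖ ^ 2 / t + ‖z - y‖ ^ 2 / (1 - t) := by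
  have h1' : 0 < 1 - t := by linarith
  have h := norm_add_le (x - z) (z - y)
  rw [sub_add_sub_cancel] at h
  have h2 : ‖x - y‖ ^ 2 ≤ (‖x - z‖ + ‖z - y‖) ^ 2 := pow_le_pow_left₀ (norm_nonneg _) h 2
  refine h2.trans ?_
  rw [← sub_nonneg]
  have : ‖x - z‖ ^ 2 / t + ‖z - y‖ ^ 2 / (1 - t) - (‖x - z‖ + ‖z - y‖) ^ 2 =
      ((1 - t) * ‖x - z‖ - t * ‖z - y‖) ^ 2 / (t * (1 - t)) := by
    field_simp; ring
  rw [this]; positivity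

/-- A midpoint measure that is no farther from the endpoints than the interpolation is the
interpolation. Any coupling of the source with the midpoint measure pays at least the dual value
plus the gap to `dispMap v u S t`; the two dual values add up to the squared distance of the
endpoints, which leaves no room for the gap of nearly optimal couplings. -/
theorem eq_map_dispMap_of_W2 (hμ : InP2 μ) (hS : S.PosDef) (v u : Eucl d) {t : ℝ} (h0 : 0 < t)
    (h1 : t < 1) {ρ : Measure (Eucl d)} (hρ : InP2 ρ)
    (hl : W2 μ ρ = t * W2 μ (μ.map (affMap v u S)))
    (hr : W2 ρ (μ.map (affMap v u S)) = (1 - t) * W2 μ (μ.map (affMap v u S))) :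
    ρ = μ.map (dispMap v u S t) := by
  have h1' : 0 < 1 - t := by linarith
  have hν : InP2 (μ.map (affMap v u S)) := hμ.map_affMap _ _ _
  have hA : (dispMatrix S t).PosDef := posDef_dispMatrix hS ⟨h0.le, h1.le⟩
  set ν := μ.map (affMap v u S) with hνdef
  set D := W2 μ ν with hD
  set f := sourcePotential v u S with hf
  set g := targetPotential v u S with hg
  set gt := targetPotential v (meanInterp v u t) (dispMatrix S t) with hgt
  have hprob := hρ.1
  have hprobμ := hμ.1
  have hDsq : D ^ 2 = ∫ x, f x ∂μ + ∫ y, g y ∂ν := by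
    rw [hD, hνdef, W2_sq_map_affMap hμ hS, integral_cost_affMap_eq hμ hS]
  -- the dual inequality on the second half, obtained by moving `z` back to the source
  have hsecond : ∀ z y : Eucl d,
      g y - (gt z - (1 - t) * ‖v‖ ^ 2) / t ≤ ‖z - y‖ ^ 2 / (1 - t) := by
    intro z y
    obtain ⟨x, rfl⟩ : ∃ x, z = dispMap v u S t x := by
      refine ⟨v + matCLM (dispMatrix S t)⁻¹ (z - meanInterp v u t), ?_⟩
      simp only [dispMap, affMap, add_sub_cancel_left, hA.matCLM_apply_inv]
      abel
    have e1 := norm_sub_sq_eq_potentials (v := v) (u := u) hS x y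
    have e2 := norm_sub_sq_eq_potentials (v := v) (u := meanInterp v u t) hA x (dispMap v u S t x)
    rw [sourcePotential_dispMatrix, dispMap, dualGap_affMap] at e2
    rw [← dispMap] at e2
    have e3 := norm_sub_sq_le_div_add_div h0 h1 x y (dispMap v u S t x)
    have e4 : ‖x - dispMap v u S t x‖ ^ 2 / t =
        f x + (gt (dispMap v u S t x) - (1 - t) * ‖v‖ ^ 2) / t := by
      rw [e2]; field_simp; ring
    have e5 := dualGap_nonneg (v := v) (u := u) hS x y
    linarith
  obtain ⟨C, hC0, hC⟩ := hA.norm_sq_le_inner_inv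
  refine (eq_of_forall_exists_coupling_lt (hμ.map_affMap _ _ _) hρ fun ε hε => ?_).symm
  -- a tolerance small enough for the coercivity constant of the gap
  obtain ⟨η, hη, hηε⟩ : ∃ η > 0, C * (η * (1 + t / (1 - t))) < ε := by
    refine ⟨ε / (2 * (C + 1) * (1 + t / (1 - t))), by positivity, ?_⟩
    have : 0 < 1 + t / (1 - t) := by positivity
    have e : C * (ε / (2 * (C + 1) * (1 + t / (1 - t))) * (1 + t / (1 - t))) =
        ε * (C / (2 * (C + 1))) := by
      generalize 1 + t / (1 - t) = k at *
      field_simp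
    rw [e]
    have : C / (2 * (C + 1)) < 1 := by rw [div_lt_one (by positivity)]; linarith
    nlinarith
  obtain ⟨π₁, hπ₁, hc₁⟩ := exists_coupling_lt hμ hρ hη
  obtain ⟨π₂, hπ₂, hc₂⟩ := exists_coupling_lt hρ hν hη
  have hprob₁ := hπ₁.1
  have hprob₂ := hπ₂.1
  rw [hl] at hc₁
  rw [hr] at hc₂
  have hgti : Integrable gt ρ := hρ.integrable_targetPotential
  have hgi : Integrable g ν := hν.integrable_targetPotential
  have k1 := hπ₁.integral_cost_eq hμ hρ hA v (meanInterp v u t)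
  have k2 : ∫ x, sourcePotential v (meanInterp v u t) (dispMatrix S t) x ∂μ =
      t * ∫ x, f x ∂μ - (1 - t) * ‖v‖ ^ 2 := by
    simp_rw [sourcePotential_dispMatrix]
    rw [integral_sub (hμ.integrable_sourcePotential.const_mul t) (integrable_const _),
      integral_const_mul]
    simp [hf]
  rw [k2] at k1
  have k3 : ∫ y, g y ∂ν - (∫ z, gt z ∂ρ - (1 - t) * ‖v‖ ^ 2) / t ≤
      (∫ p, ‖p.1 - p.2‖ ^ 2 ∂π₂) / (1 - t) := by
    have j1 := hπ₂.integrable_snd continuous_targetPotential hgi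
    have j2 := hπ₂.integrable_fst continuous_targetPotential hgti
    have j3 : Integrable (fun p : Eucl d × Eucl d => (gt p.1 - (1 - t) * ‖v‖ ^ 2) / t) π₂ :=
      (j2.sub (integrable_const _)).div_const t
    have := integral_mono (j1.sub j3) ((hπ₂.integrable_cost hρ hν).div_const (1 - t))
      fun p => hsecond p.1 p.2
    simp only [Pi.sub_apply] at this
    rw [integral_sub j1 j3, integral_div, integral_div, integral_sub j2 (integrable_const _),
      hπ₂.integral_fst (f := gt) continuous_targetPotential,
      hπ₂.integral_snd (f := g) continuous_targetPotential] at this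
    simpa using this
  have k4 : ∫ p, dualGap v (meanInterp v u t) (dispMatrix S t) p.1 p.2 ∂π₁ ≤
      η * (1 + t / (1 - t)) := by
    have a2 : (∫ p, ‖p.1 - p.2‖ ^ 2 ∂π₂) / (1 - t) ≤ (1 - t) * D ^ 2 + η / (1 - t) := by
      rw [div_le_iff₀ h1']
      have : ((1 - t) * D ^ 2 + η / (1 - t)) * (1 - t) = ((1 - t) * D) ^ 2 + η := by
        field_simp
      rw [this]; exact hc₂.le
    have a3 := k3.trans a2
    have a4 : t * (∫ y, g y ∂ν) - (∫ z, gt z ∂ρ - (1 - t) * ‖v‖ ^ 2) ≤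
        t * ((1 - t) * D ^ 2 + η / (1 - t)) := by
      have := mul_le_mul_of_nonneg_left a3 h0.le
      rwa [mul_sub, mul_div_cancel₀ _ h0.ne'] at this
    have a5 : t * (η / (1 - t)) = η * (t / (1 - t)) := by ring
    have a6 : t * D ^ 2 = t * (∫ x, f x ∂μ) + t * ∫ y, g y ∂ν := by rw [hDsq]; ring
    nlinarith
  refine ⟨π₁.map fun p => (dispMap v u S t p.1, p.2), ?_, ?_⟩
  · have h := isCoupling_map (ρ := π₁) (f := fun p => dispMap v u S t p.1) (g := fun p => p.2)
      ((continuous_affMap _ _ _).measurable.comp measurable_fst) measurable_snd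
    have e : π₁.map (fun p => dispMap v u S t p.1) = μ.map (dispMap v u S t) := by
      rw [← hπ₁.2.1, Measure.map_map (continuous_dispMap _ _ _ _).measurable measurable_fst]; rfl
    have e' : π₁.map (fun p => p.2) = ρ := hπ₁.2.2
    rwa [e, e'] at h
  · have hcd : Continuous (dispMap v u S t) := continuous_affMap _ _ _
    rw [integral_map (by fun_prop) (by fun_prop)]
    refine lt_of_le_of_lt ?_ hηε
    refine le_trans ?_ (mul_le_mul_of_nonneg_left k4 hC0)
    rw [← integral_const_mul]
    refine integral_mono_of_nonneg (Eventually.of_forall fun p => by positivity)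
      ((hπ₁.integrable_dualGap hμ hρ).const_mul C) (Eventually.of_forall fun p => ?_)
    simp only
    rw [norm_sub_rev]
    exact hC _

theorem IsGeodesic.eq_map_dispMap (hμ : InP2 μ) (hS : S.PosDef) {v u : Eucl d}
    {γ : ℝ → Measure (Eucl d)} (hγ : IsGeodesic γ μ (μ.map (affMap v u S))) {t : ℝ}
    (ht : t ∈ Icc (0 : ℝ) 1) : γ t = μ.map (dispMap v u S t) := by
  obtain ⟨hP, e0, e1, hW⟩ := hγ
  have hg := isGeodesic_map_dispMap hμ hS v u
  rcases ht.1.eq_or_lt with rfl | h0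
  · rw [e0]; exact hg.2.1.symm
  rcases ht.2.eq_or_lt with rfl | h1
  · rw [e1]; exact hg.2.2.1.symm
  refine eq_map_dispMap_of_W2 hμ hS v u h0 h1 (hP t ht) ?_ ?_
  · have := hW 0 (by simp) t ht
    rwa [e0, zero_sub, abs_neg, abs_of_pos h0] at this
  · have := hW t ht 1 (by simp)
    rwa [e1, abs_sub_comm, abs_of_pos (by linarith)] at this

end

/-! ### The transport matrix -/

section

variable {d : ℕ} {V U S : Matrix (Fin d) (Fin d) ℝ}

theorem Matrix.PosDef.cfc_sqrt (hS : S.PosDef) : (CFC.sqrt S).PosDef :=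
  isStrictlyPositive_iff_posDef.1 (IsStrictlyPositive.sqrt S (isStrictlyPositive_iff_posDef.2 hS))

theorem Matrix.PosDef.sqrt_mul_sqrt (hS : S.PosDef) : CFC.sqrt S * CFC.sqrt S = S :=
  CFC.sqrt_mul_sqrt_self S hS.posSemidef.nonneg

theorem Matrix.PosDef.symm_mul_mul (hV : V.PosDef) (hS : S.PosDef) : (S * V * S).PosDef := by
  have h := (Matrix.IsUnit.posDef_star_right_conjugate_iff hS.isUnit).2 hV
  rwa [star_eq_conjTranspose, hS.isHermitian.eq] at h

theorem posDef_transportMatrix (hV : V.PosDef) (hU : U.PosDef) : (transportMatrix V U).PosDef :=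
  (hV.symm_mul_mul hU.cfc_sqrt).cfc_sqrt.inv.symm_mul_mul hU.cfc_sqrt

theorem transportMatrix_mul_mul (hV : V.PosDef) (hU : U.PosDef) :
    transportMatrix V U * V * transportMatrix V U = U := by
  have hQ := (hV.symm_mul_mul hU.cfc_sqrt).cfc_sqrt
  have hQQ := (hV.symm_mul_mul hU.cfc_sqrt).sqrt_mul_sqrt
  have hPP := hU.sqrt_mul_sqrt
  unfold transportMatrix
  generalize CFC.sqrt (CFC.sqrt U * V * CFC.sqrt U) = Q at *
  generalize CFC.sqrt U = P at *
  calc P * Q⁻¹ * P * V * (P * Q⁻¹ * P) = P * Q⁻¹ * (P * V * P) * Q⁻¹ * P := by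
        simp only [mul_assoc]
    _ = P * (Q⁻¹ * Q) * (Q * Q⁻¹) * P := by rw [← hQQ]; simp only [mul_assoc]
    _ = U := by
        rw [Matrix.nonsing_inv_mul _ hQ.isUnit_det', Matrix.mul_nonsing_inv _ hQ.isUnit_det',
          mul_one, mul_one, hPP]

theorem trace_transportMatrix_mul (hV : V.PosDef) (hU : U.PosDef) :
    (transportMatrix V U * V).trace = (CFC.sqrt (CFC.sqrt U * V * CFC.sqrt U)).trace := by
  have hQ := (hV.symm_mul_mul hU.cfc_sqrt).cfc_sqrt
  have hQQ := (hV.symm_mul_mul hU.cfc_sqrt).sqrt_mul_sqrt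
  unfold transportMatrix
  generalize CFC.sqrt (CFC.sqrt U * V * CFC.sqrt U) = Q at *
  generalize CFC.sqrt U = P at *
  calc (P * Q⁻¹ * P * V).trace = (P * (Q⁻¹ * P * V)).trace := by simp only [mul_assoc]
    _ = (Q⁻¹ * (P * V * P)).trace := by rw [Matrix.trace_mul_comm]; simp only [mul_assoc]
    _ = Q.trace := by
        rw [← hQQ, ← mul_assoc, Matrix.nonsing_inv_mul _ hQ.isUnit_det', one_mul]

end

/-! ### Mean and covariance -/

section

variable {d : ℕ} {μ : Measure (Eucl d)} {v u : Eucl d} {V : Matrix (Fin d) (Fin d) ℝ}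

theorem MeasureTheory.MemLp.euclidean_apply {α : Type*} [MeasurableSpace α] {π : Measure α}
    {f : α → Eucl d} (hf : MemLp f 2 π) (i : Fin d) : MemLp (fun p => f p i) 2 π :=
  (EuclideanSpace.proj (𝕜 := ℝ) i).comp_memLp' hf

theorem InP2.integral_apply (h : InP2 μ) (i : Fin d) : ∫ x, x i ∂μ = (∫ x, x ∂μ) i :=
  (EuclideanSpace.proj i : Eucl d →L[ℝ] ℝ).integral_comp_comm h.integrable_id

theorem HasMeanCov.integrable_mul (h : HasMeanCov μ v V) (i j : Fin d) :
    Integrable (fun x : Eucl d => (x i - v i) * (x j - v j)) μ := by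
  have := h.1.1
  exact ((h.1.2.euclidean_apply i).sub (memLp_const _)).integrable_mul
    ((h.1.2.euclidean_apply j).sub (memLp_const _))

theorem HasMeanCov.integral_norm_sq (h : HasMeanCov μ v V) :
    ∫ x, ‖x‖ ^ 2 ∂μ = ‖v‖ ^ 2 + V.trace := by
  have := h.1.1
  have hx : ∀ i, Integrable (fun x : Eucl d => x i) μ := fun i =>
    (h.1.2.euclidean_apply i).integrable (by norm_num)
  have key : ∀ x : Eucl d, ‖x‖ ^ 2 =
      ∑ i, ((x i - v i) * (x i - v i) + (2 * v i * x i - v i ^ 2)) := fun x => by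
    rw [EuclideanSpace.real_norm_sq_eq]
    exact Finset.sum_congr rfl fun i _ => by ring
  have i1 : ∀ i, Integrable (fun x : Eucl d => 2 * v i * x i - v i ^ 2) μ := fun i =>
    ((hx i).const_mul _).sub (integrable_const _)
  rw [integral_congr_ae (Eventually.of_forall key),
    integral_finsetSum _ fun i _ => by exact (h.integrable_mul i i).add (i1 i),
    EuclideanSpace.real_norm_sq_eq, Matrix.trace, ← Finset.sum_add_distrib]
  refine Finset.sum_congr rfl fun i _ => ?_
  rw [integral_add (h.integrable_mul i i) (i1 i), h.2.2,
    integral_sub ((hx i).const_mul _) (integrable_const _), integral_const_mul, h.1.integral_apply, h.2.1]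
  simp only [integral_const, probReal_univ, smul_eq_mul, Matrix.diag_apply]
  ring

theorem affMap_sub_apply (v u : Eucl d) (A : Matrix (Fin d) (Fin d) ℝ) (x : Eucl d) (i : Fin d) :
    affMap v u A x i - u i = ∑ k, A i k * (x k - v k) := by
  simp only [affMap, PiLp.add_apply, add_sub_cancel_left]
  rfl

theorem HasMeanCov.map_affMap (h : HasMeanCov μ v V) (u : Eucl d)
    (A : Matrix (Fin d) (Fin d) ℝ) : HasMeanCov (μ.map (affMap v u A)) u (A * V * Aᵀ) := by
  have := h.1.1
  have hT := continuous_affMap v u A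
  refine ⟨h.1.map_affMap v u A, ?_, fun i j => ?_⟩
  · rw [integral_map hT.aemeasurable (by fun_prop)]
    have i1 : Integrable (fun x => x - v) μ := h.1.integrable_id.sub (integrable_const v)
    simp only [affMap]
    rw [integral_add (integrable_const u) ((matCLM A).integrable_comp i1),
      ContinuousLinearMap.integral_comp_comm _ i1,
      integral_sub h.1.integrable_id (integrable_const v), h.2.1]
    simp
  · rw [integral_map hT.aemeasurable (by fun_prop)]
    have key : ∀ x, (affMap v u A x i - u i) * (affMap v u A x j - u j) =
        ∑ l, ∑ k, A i k * A j l * ((x k - v k) * (x l - v l)) := fun x => by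
      rw [affMap_sub_apply, affMap_sub_apply, Finset.sum_mul_sum, Finset.sum_comm]
      exact Finset.sum_congr rfl fun l _ => Finset.sum_congr rfl fun k _ => by ring
    simp_rw [key]
    rw [integral_finsetSum _ fun l _ => integrable_finsetSum _ fun k _ =>
      (h.integrable_mul k l).const_mul _, Matrix.mul_apply]
    refine Finset.sum_congr rfl fun l _ => ?_
    rw [integral_finsetSum _ fun k _ => (h.integrable_mul k l).const_mul _, Matrix.mul_apply,
      Finset.sum_mul]
    refine Finset.sum_congr rfl fun k _ => ?_
    rw [integral_const_mul, h.2.2, Matrix.transpose_apply]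
    ring

theorem HasMeanCov.integral_cost_affMap (h : HasMeanCov μ v V) (u : Eucl d)
    (A : Matrix (Fin d) (Fin d) ℝ) :
    ∫ x, ‖x - affMap v u A x‖ ^ 2 ∂μ =
      ‖v - u‖ ^ 2 + ((1 - A) * V * (1 - A)ᵀ).trace := by
  rw [← (h.map_affMap (v - u) (1 - A)).integral_norm_sq,
    integral_map (continuous_affMap _ _ _).aemeasurable (by fun_prop)]
  refine integral_congr_ae (Eventually.of_forall fun x => ?_)
  have : affMap v (v - u) (1 - A) x = x - affMap v u A x := by
    simp only [affMap, matCLM, map_sub, map_one]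
    simp only [_root_.sub_apply, one_apply_eq_self]
    abel
  simp only [this]

/-- The value of the squared distance between a measure and its image under the affine map given
by the transport matrix depends on means and covariance matrices only. -/
theorem HasMeanCov.W2_sq_eq_buresSq (h : HasMeanCov μ v V) (u : Eucl d)
    {U : Matrix (Fin d) (Fin d) ℝ} (hV : V.PosDef) (hU : U.PosDef) :
    W2 μ (μ.map (affMap v u (transportMatrix V U))) ^ 2 = buresSq v u V U := by
  have hW := posDef_transportMatrix hV hU
  have hWt : (transportMatrix V U)ᵀ = transportMatrix V U := by
    have := hW.isHermitian.eq
    rwa [conjTranspose_eq_transpose_of_trivial] at this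
  have e := transportMatrix_mul_mul hV hU
  have e2 := trace_transportMatrix_mul hV hU
  rw [W2_sq_map_affMap h.1 hW, h.integral_cost_affMap, buresSq, ← e2]
  rw [Matrix.transpose_sub, Matrix.transpose_one, hWt]
  have e3 : (1 - transportMatrix V U) * V * (1 - transportMatrix V U) =
      V + U - transportMatrix V U * V - V * transportMatrix V U := by
    generalize transportMatrix V U = W at *
    rw [← e]; noncomm_ring
  rw [e3, Matrix.trace_sub, Matrix.trace_sub, Matrix.trace_add,
    Matrix.trace_mul_comm V (transportMatrix V U)]
  ring

theorem hasMeanCov_multivariateGaussian (v : Eucl d) (hV : V.PosDef) :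
    HasMeanCov (multivariateGaussian v V) v V := by
  have hi : InP2 (multivariateGaussian v V) := ⟨inferInstance, IsGaussian.memLp_two_id⟩
  refine ⟨hi, integral_id_multivariateGaussian, fun i j => ?_⟩
  have hm : ∀ i, ∫ x, x i ∂(multivariateGaussian v V) = v i := fun i => by
    rw [hi.integral_apply, integral_id_multivariateGaussian]
  have := covariance_eval_multivariateGaussian (μ := v) hV.posSemidef i j
  rw [covariance, hm, hm] at this
  exact this

theorem map_affMap_multivariateGaussian (v u : Eucl d) (hV : V.PosDef)
    {A : Matrix (Fin d) (Fin d) ℝ} (hA : (A * V * Aᵀ).PosDef) :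
    (multivariateGaussian v V).map (affMap v u A) = multivariateGaussian u (A * V * Aᵀ) := by
  have e : affMap v u A = (fun x => (u - matCLM A v) + x) ∘ matCLM A := by
    funext x; simp [affMap]; abel
  have hm : (multivariateGaussian v V).map (affMap v u A) =
      ((multivariateGaussian v V).map (matCLM A)).map (fun x => (u - matCLM A v) + x) := by
    rw [e, Measure.map_map (by fun_prop) (by fun_prop)]
  have hg : IsGaussian ((multivariateGaussian v V).map (affMap v u A)) := by
    rw [hm]; infer_instance
  refine IsGaussian.ext ?_ ?_
  · simp only [id_eq, integral_id_multivariateGaussian]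
    exact ((hasMeanCov_multivariateGaussian v hV).map_affMap u A).2.1
  · ext x y
    have hadj : (matCLM A).adjoint = matCLM Aᵀ := by
      rw [← conjTranspose_eq_transpose_of_trivial, ← star_eq_conjTranspose, matCLM, matCLM,
        map_star]
      rfl
    rw [hm, covarianceBilin_map_const_add, covarianceBilin_map IsGaussian.memLp_two_id,
      covarianceBilin_multivariateGaussian hA.posSemidef,
      covarianceBilin_multivariateGaussian hV.posSemidef, hadj]
    simp only [matCLM, ofLp_toEuclideanCLM, ← Matrix.mulVec_mulVec]
    rw [Matrix.dotProduct_mulVec x.ofLp A, ← Matrix.mulVec_transpose]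

end

/-! ### Affine images of the `φ`-exponential profile -/

section

variable {d : ℕ} {φ : ℝ → ℝ} {lam c : ℝ}

theorem det_matCLM (A : Matrix (Fin d) (Fin d) ℝ) : (matCLM A).det = A.det := by
  rw [ContinuousLinearMap.det, coe_toEuclideanCLM_eq_toEuclideanLin]
  exact LinearMap.det_toLpLin 2 A

theorem Matrix.bijective_affMap {A : Matrix (Fin d) (Fin d) ℝ} (hA : IsUnit A.det)
    (v u : Eucl d) : Function.Bijective (affMap v u A) := by
  refine Function.bijective_iff_has_inverse.2 ⟨affMap u v A⁻¹, fun x => ?_, fun x => ?_⟩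
  · simp only [affMap, add_sub_cancel_left, ← matCLM_mul_apply, Matrix.nonsing_inv_mul _ hA,
      matCLM_one_apply]
    abel
  · simp only [affMap, add_sub_cancel_left, ← matCLM_mul_apply, Matrix.mul_nonsing_inv _ hA,
      matCLM_one_apply]
    abel

theorem map_affMap_phiGaussian (φ : ℝ → ℝ) (lam c : ℝ) (v u : Eucl d)
    (V : Matrix (Fin d) (Fin d) ℝ) {A : Matrix (Fin d) (Fin d) ℝ} (hA : IsUnit A.det) :
    (phiGaussian φ lam c v V).map (affMap v u A) = phiGaussian φ lam c u (A * V * Aᵀ) := by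
  have hb := Matrix.bijective_affMap hA v u
  have hT := continuous_affMap v u A
  ext s hs
  rw [Measure.map_apply hT.measurable hs, phiGaussian, phiGaussian,
    withDensity_apply _ (hT.measurable hs), withDensity_apply _ hs]
  conv_rhs => rw [← Set.image_preimage_eq s hb.2]
  rw [lintegral_image_eq_lintegral_abs_det_fderiv_mul volume (hT.measurable hs)
    (f' := fun _ => matCLM A) (fun x _ => ?_) hb.1.injOn]
  · refine lintegral_congr fun x => ?_
    have e1 : (affMap v u A x - u).ofLp = A *ᵥ (x - v).ofLp := by
      simp only [affMap, add_sub_cancel_left, matCLM, ofLp_toEuclideanCLM]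
    have e2 : (A *ᵥ (x - v).ofLp) ⬝ᵥ ((A * V * Aᵀ)⁻¹ *ᵥ (A *ᵥ (x - v).ofLp)) =
        (x - v).ofLp ⬝ᵥ (V⁻¹ *ᵥ (x - v).ofLp) := by
      have hAt : IsUnit Aᵀ.det := by rwa [Matrix.det_transpose]
      rw [Matrix.mul_inv_rev, Matrix.mul_inv_rev, Matrix.mulVec_mulVec, mul_assoc, mul_assoc,
        Matrix.nonsing_inv_mul _ hA, mul_one, ← Matrix.mulVec_mulVec, Matrix.dotProduct_mulVec,
        Matrix.vecMul_mulVec, Matrix.mul_nonsing_inv _ hAt, Matrix.vecMul_one]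
    have hpos : 0 < |A.det| := abs_pos.2 hA.ne_zero
    have e3 : ENNReal.ofReal |A.det| * ENNReal.ofReal (Real.sqrt (A * V * Aᵀ).det)⁻¹ =
        ENNReal.ofReal (Real.sqrt V.det)⁻¹ := by
      have : (A * V * Aᵀ).det = A.det ^ 2 * V.det := by
        rw [Matrix.det_mul, Matrix.det_mul, Matrix.det_transpose]; ring
      rw [this, Real.sqrt_mul (sq_nonneg _), Real.sqrt_sq_eq_abs,
        ← ENNReal.ofReal_mul (abs_nonneg _), mul_inv, ← mul_assoc, mul_inv_cancel₀ hpos.ne',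
        one_mul]
    rw [det_matCLM, e1, e2, ← e3]
    ring
  · have : HasFDerivAt (affMap v u A) (matCLM A) x := by
      unfold affMap
      exact ((matCLM A).hasFDerivAt.comp x ((hasFDerivAt_id x).sub_const v)).const_add u
    exact this.hasFDerivWithinAt

theorem hasMeanCov_phiGaussian (h : IsStandardPair d φ lam c) (v : Eucl d)
    {V : Matrix (Fin d) (Fin d) ℝ} (hV : V.PosDef) :
    HasMeanCov (phiGaussian φ lam c v V) v V := by
  have e : CFC.sqrt V * 1 * (CFC.sqrt V)ᵀ = V := by
    have h1 := hV.cfc_sqrt.isHermitian.eq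
    rw [conjTranspose_eq_transpose_of_trivial] at h1
    rw [h1, mul_one, hV.sqrt_mul_sqrt]
  have h2 := h.2.2.2.map_affMap v (CFC.sqrt V)
  rwa [map_affMap_phiGaussian _ _ _ _ _ _ hV.cfc_sqrt.isUnit_det', e] at h2

theorem map_affMap_phiGaussian_of_posDef (φ : ℝ → ℝ) (lam c : ℝ) (v u : Eucl d)
    (V : Matrix (Fin d) (Fin d) ℝ) {S : Matrix (Fin d) (Fin d) ℝ} (hS : S.PosDef) :
    (phiGaussian φ lam c v V).map (affMap v u S) = phiGaussian φ lam c u (S * V * S) := by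
  have h1 := hS.isHermitian.eq
  rw [conjTranspose_eq_transpose_of_trivial] at h1
  rw [map_affMap_phiGaussian _ _ _ _ _ _ hS.isUnit_det', h1]

theorem HasMeanCov.unique {μ : Measure (Eucl d)} {v u : Eucl d} {V U : Matrix (Fin d) (Fin d) ℝ}
    (h : HasMeanCov μ v V) (h' : HasMeanCov μ u U) : v = u ∧ V = U := by
  obtain rfl : v = u := h.2.1.symm.trans h'.2.1
  exact ⟨rfl, Matrix.ext fun i j => (h.2.2 i j).symm.trans (h'.2.2 i j)⟩

end

/-! ### Geodesics between affine images of the profile -/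

section

variable {d : ℕ} {φ : ℝ → ℝ} {lam c : ℝ}

theorem posDef_covInterp {V U : Matrix (Fin d) (Fin d) ℝ} (hV : V.PosDef) (hU : U.PosDef) {t : ℝ}
    (ht : t ∈ Icc (0 : ℝ) 1) : (covInterp V U t).PosDef :=
  hV.symm_mul_mul (posDef_dispMatrix (posDef_transportMatrix hV hU) ht)

theorem map_transport_phiGaussian (φ : ℝ → ℝ) (lam c : ℝ) (v u : Eucl d)
    {V U : Matrix (Fin d) (Fin d) ℝ} (hV : V.PosDef) (hU : U.PosDef) :
    (phiGaussian φ lam c v V).map (affMap v u (transportMatrix V U)) =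
      phiGaussian φ lam c u U := by
  rw [map_affMap_phiGaussian_of_posDef _ _ _ _ _ _ (posDef_transportMatrix hV hU),
    transportMatrix_mul_mul hV hU]

theorem map_dispMap_phiGaussian (φ : ℝ → ℝ) (lam c : ℝ) (v u : Eucl d)
    {V U : Matrix (Fin d) (Fin d) ℝ} (hV : V.PosDef) (hU : U.PosDef) {t : ℝ}
    (ht : t ∈ Icc (0 : ℝ) 1) :
    (phiGaussian φ lam c v V).map (dispMap v u (transportMatrix V U) t) =
      phiGaussian φ lam c (meanInterp v u t) (covInterp V U t) :=
  map_affMap_phiGaussian_of_posDef _ _ _ _ _ _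
    (posDef_dispMatrix (posDef_transportMatrix hV hU) ht)

theorem W2_sq_phiGaussian (h : IsStandardPair d φ lam c) (v u : Eucl d)
    {V U : Matrix (Fin d) (Fin d) ℝ} (hV : V.PosDef) (hU : U.PosDef) :
    W2 (phiGaussian φ lam c v V) (phiGaussian φ lam c u U) ^ 2 = buresSq v u V U := by
  rw [← map_transport_phiGaussian φ lam c v u hV hU]
  exact (hasMeanCov_phiGaussian h v hV).W2_sq_eq_buresSq u hV hU

theorem W2_sq_multivariateGaussian (v u : Eucl d)
    {V U : Matrix (Fin d) (Fin d) ℝ} (hV : V.PosDef) (hU : U.PosDef) :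
    W2 (multivariateGaussian v V) (multivariateGaussian u U) ^ 2 = buresSq v u V U := by
  have hW := posDef_transportMatrix hV hU
  have hWt := hW.isHermitian.eq
  rw [conjTranspose_eq_transpose_of_trivial] at hWt
  have e : transportMatrix V U * V * (transportMatrix V U)ᵀ = U := by
    rw [hWt, transportMatrix_mul_mul hV hU]
  have h := map_affMap_multivariateGaussian v u hV (A := transportMatrix V U) (by rwa [e])
  rw [e] at h
  rw [← h]
  exact (hasMeanCov_multivariateGaussian v hV).W2_sq_eq_buresSq u hV hU

theorem isGeodesic_phiGaussian (h : IsStandardPair d φ lam c) (v u : Eucl d)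
    {V U : Matrix (Fin d) (Fin d) ℝ} (hV : V.PosDef) (hU : U.PosDef) :
    IsGeodesic (fun t => phiGaussian φ lam c (meanInterp v u t) (covInterp V U t))
      (phiGaussian φ lam c v V) (phiGaussian φ lam c u U) := by
  have hg := isGeodesic_map_dispMap (hasMeanCov_phiGaussian h v hV).1
    (posDef_transportMatrix hV hU) v u
  rw [map_transport_phiGaussian φ lam c v u hV hU] at hg
  have e := fun t (ht : t ∈ Icc (0 : ℝ) 1) => map_dispMap_phiGaussian φ lam c v u hV hU ht
  obtain ⟨g1, g2, g3, g4⟩ := hg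
  refine ⟨fun t ht => ?_, ?_, ?_, fun s hs t ht => ?_⟩ <;> beta_reduce
  · rw [← e t ht]; exact g1 t ht
  · rw [← e 0 (by simp)]; exact g2
  · rw [← e 1 (by simp)]; exact g3
  · simp only [← e s hs, ← e t ht]; exact g4 s hs t ht

theorem IsGeodesic.eq_phiGaussian (h : IsStandardPair d φ lam c) {v u : Eucl d}
    {V U : Matrix (Fin d) (Fin d) ℝ} (hV : V.PosDef) (hU : U.PosDef) {γ : ℝ → Measure (Eucl d)}
    (hγ : IsGeodesic γ (phiGaussian φ lam c v V) (phiGaussian φ lam c u U)) {t : ℝ}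
    (ht : t ∈ Icc (0 : ℝ) 1) :
    γ t = phiGaussian φ lam c (meanInterp v u t) (covInterp V U t) := by
  rw [← map_transport_phiGaussian φ lam c v u hV hU] at hγ
  rw [hγ.eq_map_dispMap (hasMeanCov_phiGaussian h v hV).1 (posDef_transportMatrix hV hU) ht,
    map_dispMap_phiGaussian φ lam c v u hV hU ht]

theorem exists_gaussian_correspondence (h : IsStandardPair d φ lam c) :
    ∃ T : Measure (Eucl d) → Measure (Eucl d),
      BijOn T (gaussianSpace d) (phiGaussianSpace d φ lam c) ∧
      (∀ (v : Eucl d) (V : Matrix (Fin d) (Fin d) ℝ), V.PosDef →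
        T (multivariateGaussian v V) = phiGaussian φ lam c v V) ∧
      ∀ μ ∈ gaussianSpace d, ∀ ν ∈ gaussianSpace d, W2 (T μ) (T ν) = W2 μ ν := by
  -- mean and covariance matrix recover the parameters of a Gaussian measure
  let T : Measure (Eucl d) → Measure (Eucl d) := fun μ =>
    phiGaussian φ lam c (∫ x, x ∂μ) (Matrix.of fun i j =>
      ∫ x, (x i - (∫ y, y ∂μ) i) * (x j - (∫ y, y ∂μ) j) ∂μ)
  have hT : ∀ (v : Eucl d) (V : Matrix (Fin d) (Fin d) ℝ), V.PosDef →
      T (multivariateGaussian v V) = phiGaussian φ lam c v V := by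
    intro v V hV
    have hm := hasMeanCov_multivariateGaussian v hV
    simp only [T, hm.2.1, hm.2.2]
    rfl
  refine ⟨T, ⟨?_, ?_, ?_⟩, hT, ?_⟩
  · rintro _ ⟨v, V, hV, rfl⟩
    exact ⟨v, V, hV, hT v V hV⟩
  · rintro _ ⟨v, V, hV, rfl⟩ _ ⟨u, U, hU, rfl⟩ he
    rw [hT v V hV, hT u U hU] at he
    have h1 := hasMeanCov_phiGaussian h v hV
    rw [he] at h1
    obtain ⟨rfl, rfl⟩ := h1.unique (hasMeanCov_phiGaussian h u hU)
    rfl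
  · rintro _ ⟨v, V, hV, rfl⟩
    exact ⟨_, ⟨v, V, hV, rfl⟩, hT v V hV⟩
  · rintro _ ⟨v, V, hV, rfl⟩ _ ⟨u, U, hU, rfl⟩
    rw [hT v V hV, hT u U hU]
    refine (pow_left_inj₀ (W2_nonneg _ _) (W2_nonneg _ _) two_ne_zero).1 ?_
    rw [W2_sq_phiGaussian h v u hV hU, W2_sq_multivariateGaussian v u hV hU]

theorem geodesicallyConvex_phiGaussianSpace (h : IsStandardPair d φ lam c) :
    GeodesicallyConvex (phiGaussianSpace d φ lam c) := by
  rintro _ ⟨v, V, hV, rfl⟩ _ ⟨u, U, hU, rfl⟩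
  exact ⟨⟨_, isGeodesic_phiGaussian h v u hV hU⟩, fun γ hγ t ht =>
    ⟨_, _, posDef_covInterp hV hU ht, hγ.eq_phiGaussian h hV hU ht⟩⟩

end

/-! ### The `φ`-logarithm and its inverse -/

section

variable {φ : ℝ → ℝ}

theorem intervalIntegrable_one_div (hp : ∀ s ∈ Ioi (0 : ℝ), 0 < φ s)
    (hc : ContinuousOn φ (Ioi 0)) {a b : ℝ} (ha : 0 < a) (hb : 0 < b) :
    IntervalIntegrable (fun s => 1 / φ s) volume a b := by
  have hsub : uIcc a b ⊆ Ioi 0 := fun x hx => lt_of_lt_of_le (lt_min ha hb) hx.1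
  exact (continuousOn_const.div (hc.mono hsub) fun x hx => (hp x (hsub hx)).ne').intervalIntegrable

theorem lnPhi_sub (hp : ∀ s ∈ Ioi (0 : ℝ), 0 < φ s) (hc : ContinuousOn φ (Ioi 0)) {a b : ℝ}
    (ha : 0 < a) (hb : 0 < b) : lnPhi φ b - lnPhi φ a = ∫ s in a..b, 1 / φ s :=
  intervalIntegral.integral_interval_sub_left (intervalIntegrable_one_div hp hc one_pos hb)
    (intervalIntegrable_one_div hp hc one_pos ha)

theorem lnPhi_one : lnPhi φ 1 = 0 := intervalIntegral.integral_same

theorem strictMonoOn_lnPhi (hp : ∀ s ∈ Ioi (0 : ℝ), 0 < φ s) (hc : ContinuousOn φ (Ioi 0)) :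
    StrictMonoOn (lnPhi φ) (Ioi 0) := by
  intro a ha b hb hab
  rw [← sub_pos, lnPhi_sub hp hc ha hb]
  exact intervalIntegral.intervalIntegral_pos_of_pos_on (intervalIntegrable_one_div hp hc ha hb)
    (fun x hx => one_div_pos.2 (hp x (lt_trans (mem_Ioi.1 ha) hx.1))) hab

theorem continuousOn_lnPhi (hp : ∀ s ∈ Ioi (0 : ℝ), 0 < φ s) (hc : ContinuousOn φ (Ioi 0)) :
    ContinuousOn (lnPhi φ) (Ioi 0) := by
  intro t ht
  have h1 : ContinuousOn (fun s => 1 / φ s) (Ioi 0) :=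
    continuousOn_const.div hc fun x hx => (hp x hx).ne'
  exact (intervalIntegral.integral_hasDerivAt_right (intervalIntegrable_one_div hp hc one_pos ht)
    (h1.stronglyMeasurableAtFilter isOpen_Ioi t ht)
    (h1.continuousAt (Ioi_mem_nhds ht))).continuousAt.continuousWithinAt

theorem div_le_lnPhi_sub (hm : MonotoneOn φ (Ioi 0)) (hp : ∀ s ∈ Ioi (0 : ℝ), 0 < φ s)
    (hc : ContinuousOn φ (Ioi 0)) {a b : ℝ} (ha : 0 < a) (hab : a ≤ b) :
    (b - a) / φ b ≤ lnPhi φ b - lnPhi φ a := by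
  have hb := ha.trans_le hab
  rw [lnPhi_sub hp hc ha hb]
  calc (b - a) / φ b = ∫ _ in a..b, 1 / φ b := by
        rw [intervalIntegral.integral_const, smul_eq_mul]; ring
    _ ≤ _ := intervalIntegral.integral_mono_on hab intervalIntegrable_const
        (intervalIntegrable_one_div hp hc ha hb) fun x hx =>
          one_div_le_one_div_of_le (hp x (ha.trans_le hx.1)) (hm (ha.trans_le hx.1) hb hx.2)

/-- The super-level sets of `exp_φ` in terms of `ln_φ`; this is the only form in which the
inverse enters the integrals below, and it absorbs the extension by `0` and `∞`. -/
theorem ofReal_lt_expPhi_iff (hp : ∀ s ∈ Ioi (0 : ℝ), 0 < φ s) (hc : ContinuousOn φ (Ioi 0))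
    {s τ : ℝ} (hs : 0 < s) : ENNReal.ofReal s < expPhi φ τ ↔ lnPhi φ s < τ := by
  have hmono := strictMonoOn_lnPhi hp hc
  unfold expPhi
  split_ifs with h1 h2
  · have : (τ : EReal) ≤ (lnPhi φ s : EReal) := h1.trans (iInf₂_le s hs)
    simpa using EReal.coe_le_coe_iff.1 this
  · obtain ⟨a, ha, haτ⟩ : ∃ a ∈ Ioi (0 : ℝ), lnPhi φ a < τ := by
      have := lt_of_not_ge h1
      simp only [lowerPhi, iInf_lt_iff, EReal.coe_lt_coe_iff] at this
      simpa using this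
    obtain ⟨b, hb, hbτ⟩ : ∃ b ∈ Ioi (0 : ℝ), τ < lnPhi φ b := by
      simp only [upperPhi, lt_iSup_iff, EReal.coe_lt_coe_iff] at h2
      simpa using h2
    have hex : τ ∈ lnPhi φ '' Ioi 0 :=
      isPreconnected_Ioi.intermediate_value ha hb (continuousOn_lnPhi hp hc) ⟨haτ.le, hbτ.le⟩
    have hpos := Function.invFunOn_mem hex
    have heq := Function.invFunOn_eq hex
    rw [ENNReal.ofReal_lt_ofReal_iff hpos, ← hmono.lt_iff_lt hs hpos, heq]
  · simp only [ENNReal.ofReal_lt_top, true_iff]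
    have h3 : lnPhi φ s < lnPhi φ (2 * s) :=
      hmono hs (show (0 : ℝ) < 2 * s by linarith) (by linarith)
    have h4 : (lnPhi φ (2 * s) : EReal) ≤ upperPhi φ :=
      le_iSup₂ (f := fun t (_ : t ∈ Ioi (0 : ℝ)) => (lnPhi φ t : EReal)) (2 * s)
        (show (0 : ℝ) < 2 * s by linarith)
    exact h3.trans_le (EReal.coe_le_coe_iff.1 (h4.trans (not_lt.1 h2)))

theorem volume_setOf_ofReal_lt (a : ℝ≥0∞) :
    volume {s : ℝ | 0 < s ∧ ENNReal.ofReal s < a} = a := by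
  rcases eq_or_ne a ∞ with rfl | ha
  · have : {s : ℝ | 0 < s ∧ ENNReal.ofReal s < ∞} = Ioi 0 := by ext; simp
    rw [this, Real.volume_Ioi]
  · have : {s : ℝ | 0 < s ∧ ENNReal.ofReal s < a} = Ioo 0 a.toReal := by
      ext s
      simp only [mem_ofPred_eq, mem_Ioo, and_congr_right_iff]
      intro hs
      rw [← ENNReal.ofReal_lt_ofReal_iff_of_nonneg hs.le, ENNReal.ofReal_toReal ha]
    rw [this, Real.volume_Ioo, sub_zero, ENNReal.ofReal_toReal ha]

theorem expPhi_eq_volume (hp : ∀ s ∈ Ioi (0 : ℝ), 0 < φ s) (hc : ContinuousOn φ (Ioi 0)) (τ : ℝ) :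
    expPhi φ τ = volume {s : ℝ | 0 < s ∧ lnPhi φ s < τ} := by
  rw [← volume_setOf_ofReal_lt (expPhi φ τ)]
  congr 1
  ext s
  exact and_congr_right fun hs => ofReal_lt_expPhi_iff hp hc hs

theorem monotone_expPhi (hp : ∀ s ∈ Ioi (0 : ℝ), 0 < φ s) (hc : ContinuousOn φ (Ioi 0)) :
    Monotone (expPhi φ) := by
  intro a b hab
  rw [expPhi_eq_volume hp hc, expPhi_eq_volume hp hc]
  exact measure_mono fun s hs => ⟨hs.1, hs.2.trans_le hab⟩

theorem measurable_indicator_lnPhi (hp : ∀ s ∈ Ioi (0 : ℝ), 0 < φ s)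
    (hc : ContinuousOn φ (Ioi 0)) : Measurable ((Ioi (0 : ℝ)).indicator (lnPhi φ)) := by
  classical
  rw [← Set.piecewise_eq_indicator]
  exact (continuousOn_lnPhi hp hc).measurable_piecewise continuousOn_const measurableSet_Ioi

/-! ### Radial integrals of the profile -/

/-- Layer-cake formula for the radial profile `exp_φ(lam - c |x|²)` against a weight. -/
theorem lintegral_expPhi_mul (hp : ∀ s ∈ Ioi (0 : ℝ), 0 < φ s) (hc : ContinuousOn φ (Ioi 0))
    {d : ℕ} (lam c : ℝ) {F : Eucl d → ℝ≥0∞} (hF : Measurable F) :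
    ∫⁻ x, expPhi φ (lam - c * ‖x‖ ^ 2) * F x =
      ∫⁻ s in Ioi (0 : ℝ), ∫⁻ x in {x : Eucl d | c * ‖x‖ ^ 2 < lam - lnPhi φ s}, F x := by
  set ℓ := (Ioi (0 : ℝ)).indicator (lnPhi φ) with hℓ
  have hℓm : Measurable ℓ := measurable_indicator_lnPhi hp hc
  have hℓe : ∀ s, 0 < s → ℓ s = lnPhi φ s := fun s hs => indicator_of_mem (mem_Ioi.2 hs) _
  let E : Set (Eucl d × ℝ) := {p | c * ‖p.1‖ ^ 2 < lam - ℓ p.2}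
  have hE : MeasurableSet E := measurableSet_lt (by fun_prop) (by fun_prop)
  have h1 : ∀ x : Eucl d, expPhi φ (lam - c * ‖x‖ ^ 2) * F x =
      ∫⁻ s in Ioi (0 : ℝ), E.indicator (fun p => F p.1) (x, s) := by
    intro x
    have e : ∀ s, E.indicator (fun p => F p.1) (x, s) =
        F x * {s | c * ‖x‖ ^ 2 < lam - ℓ s}.indicator 1 s := by
      intro s
      by_cases h : c * ‖x‖ ^ 2 < lam - ℓ s
      · rw [indicator_of_mem (show (x, s) ∈ E from h), indicator_of_mem (by exact h)]; simp
      · rw [indicator_of_notMem (show (x, s) ∉ E from h), indicator_of_notMem (by exact h)]; simp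
    have hms : MeasurableSet {s | c * ‖x‖ ^ 2 < lam - ℓ s} :=
      measurableSet_lt (by fun_prop) (by fun_prop)
    simp_rw [e]
    rw [lintegral_const_mul _ (measurable_one.indicator hms), lintegral_indicator_one hms,
      Measure.restrict_apply hms, expPhi_eq_volume hp hc, mul_comm]
    congr 2
    ext s
    simp only [mem_ofPred_eq, mem_inter_iff, mem_Ioi]
    constructor
    · rintro ⟨h1, h2⟩; exact ⟨by rw [hℓe s h1]; linarith, h1⟩
    · rintro ⟨h1, h2⟩; rw [hℓe s h2] at h1; exact ⟨h2, by linarith⟩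
  simp_rw [h1]
  have hmeas : Measurable (Function.uncurry fun x s => E.indicator (fun p => F p.1) (x, s)) :=
    (hF.comp measurable_fst).indicator hE
  rw [lintegral_lintegral_swap hmeas.aemeasurable]
  refine setLIntegral_congr_fun measurableSet_Ioi fun s hs => ?_
  have hms : MeasurableSet {x : Eucl d | c * ‖x‖ ^ 2 < lam - lnPhi φ s} :=
    measurableSet_lt (by fun_prop) (by fun_prop)
  rw [← lintegral_indicator hms]
  refine lintegral_congr fun x => ?_
  simp only [indicator, E, mem_ofPred_eq, hℓe s hs]

open scoped Pointwise in
theorem setLIntegral_norm_pow {d : ℕ} (hd : 0 < d) (k : ℕ) {c : ℝ} (hc : 0 < c) (a : ℝ) :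
    ∫⁻ x in {x : Eucl d | c * ‖x‖ ^ 2 < a}, ENNReal.ofReal (‖x‖ ^ k) =
      ENNReal.ofReal ((c ^ (((d + k : ℕ) : ℝ) / 2))⁻¹ * (max a 0) ^ (((d + k : ℕ) : ℝ) / 2)) *
        ∫⁻ x in Metric.ball (0 : Eucl d) 1, ENNReal.ofReal (‖x‖ ^ k) := by
  have hr : (0 : ℝ) < ((d + k : ℕ) : ℝ) / 2 := by positivity
  rcases le_or_gt a 0 with ha | ha
  · have : {x : Eucl d | c * ‖x‖ ^ 2 < a} = ∅ := by
      ext x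
      simp only [mem_ofPred_eq, mem_empty_iff_false, iff_false, not_lt]
      exact ha.trans (by positivity)
    rw [this, max_eq_right ha, Real.zero_rpow hr.ne']
    simp
  · set ρ := Real.sqrt (a / c) with hρ
    have hρ0 : 0 < ρ := Real.sqrt_pos.2 (by positivity)
    have hset : {x : Eucl d | c * ‖x‖ ^ 2 < a} = (matCLM (ρ • (1 : Matrix (Fin d) (Fin d) ℝ))) ''
        Metric.ball (0 : Eucl d) 1 := by
      have e : ∀ x : Eucl d, matCLM (ρ • (1 : Matrix (Fin d) (Fin d) ℝ)) x = ρ • x := fun x => by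
        simp [matCLM, map_smul]
      have h1 : (matCLM (ρ • (1 : Matrix (Fin d) (Fin d) ℝ))) '' Metric.ball (0 : Eucl d) 1 =
          ρ • Metric.ball (0 : Eucl d) 1 := by
        rw [← image_smul]; exact image_congr fun x _ => e x
      rw [h1, smul_ball hρ0.ne', smul_zero, mul_one, Real.norm_of_nonneg hρ0.le]
      ext x
      rw [mem_ball_zero_iff, hρ, Real.lt_sqrt (norm_nonneg _), lt_div_iff₀ hc, mul_comm]
      rfl
    have hdet : (matCLM (ρ • (1 : Matrix (Fin d) (Fin d) ℝ))).det = ρ ^ d := by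
      rw [det_matCLM, Matrix.det_smul, Matrix.det_one, mul_one, Fintype.card_fin]
    have happ : ∀ x : Eucl d, matCLM (ρ • (1 : Matrix (Fin d) (Fin d) ℝ)) x = ρ • x := fun x => by
      simp [matCLM, map_smul]
    rw [hset, lintegral_image_eq_lintegral_abs_det_fderiv_mul volume measurableSet_ball
      (f' := fun _ => matCLM (ρ • (1 : Matrix (Fin d) (Fin d) ℝ)))
      (fun x _ => (ContinuousLinearMap.hasFDerivAt _).hasFDerivWithinAt)
      (fun x _ y _ h => by
        simp only [happ] at h
        exact smul_right_injective _ hρ0.ne' h)]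
    have hpow : (c ^ (((d + k : ℕ) : ℝ) / 2))⁻¹ * (max a 0) ^ (((d + k : ℕ) : ℝ) / 2) =
        ρ ^ (d + k) := by
      rw [max_eq_left ha.le, hρ, Real.sqrt_eq_rpow, ← Real.rpow_natCast, ← Real.rpow_mul
        (by positivity), Real.div_rpow ha.le hc.le, one_div_mul_eq_div]
      exact (div_eq_inv_mul _ _).symm
    rw [hpow, ← lintegral_const_mul _ (by fun_prop)]
    refine lintegral_congr fun x => ?_
    rw [hdet, happ, norm_smul, Real.norm_of_nonneg hρ0.le, mul_pow, abs_of_pos (by positivity),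
      ← ENNReal.ofReal_mul (by positivity), ← ENNReal.ofReal_mul (by positivity), pow_add]
    congr 1
    ring

theorem setLIntegral_ball_norm_pow_pos {d : ℕ} (hd : 0 < d) (k : ℕ) :
    0 < ∫⁻ x in Metric.ball (0 : Eucl d) 1, ENNReal.ofReal (‖x‖ ^ k) := by
  have : Nonempty (Fin d) := ⟨⟨0, hd⟩⟩
  rw [lintegral_pos_iff_support (by fun_prop), Measure.restrict_apply
    (measurableSet_support (by fun_prop))]
  have hopen : IsOpen (Metric.ball (0 : Eucl d) 1 \ {0}) :=
    Metric.isOpen_ball.sdiff isClosed_singleton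
  have hne : (Metric.ball (0 : Eucl d) 1 \ {0}).Nonempty := by
    obtain ⟨x, hx⟩ := exists_norm_eq (Eucl d) (c := 1 / 2) (by norm_num)
    refine ⟨x, ?_, ?_⟩
    · rw [mem_ball_zero_iff, hx]; norm_num
    · rw [mem_singleton_iff, ← norm_eq_zero, hx]; norm_num
  refine (hopen.measure_pos volume hne).trans_le (measure_mono fun x hx => ⟨?_, hx.1⟩)
  have : 0 < ‖x‖ := norm_pos_iff.2 hx.2
  simp only [Function.mem_support, ne_eq, ENNReal.ofReal_eq_zero, not_le]
  positivity

theorem setLIntegral_ball_norm_pow_lt_top {d : ℕ} (k : ℕ) :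
    ∫⁻ x in Metric.ball (0 : Eucl d) 1, ENNReal.ofReal (‖x‖ ^ k) < ∞ := by
  calc _ ≤ ∫⁻ x in Metric.ball (0 : Eucl d) 1, 1 := by
        refine setLIntegral_mono measurable_const fun x hx => ?_
        rw [ENNReal.ofReal_le_one]
        exact pow_le_one₀ (norm_nonneg _) (mem_ball_zero_iff.1 hx).le
    _ < ∞ := by simpa using measure_ball_lt_top

end

/-! ### The growth conditions -/

section

variable {φ : ℝ → ℝ}

theorem exists_of_deltaZero_lt {a : ℝ} (ha : 0 < a) (h : deltaZero φ < (a : EReal)) :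
    ∃ δ : ℝ, 0 < δ ∧ δ < a ∧ ∃ C : ℝ, 0 ≤ C ∧ ∃ s₀ : ℝ, 0 < s₀ ∧
      ∀ s, 0 < s → s ≤ s₀ → 1 / φ s ≤ C * s ^ (-(1 + δ)) := by
  obtain ⟨_, ⟨δ, ⟨l, hl⟩, rfl⟩, hδ⟩ := sInf_lt_iff.1 h
  replace hδ : δ < a := EReal.coe_lt_coe_iff.1 hδ
  -- enlarging the exponent keeps the bound near `0`, so it may be taken positive
  have hev : ∀ᶠ s in 𝓝[>] (0 : ℝ), s ^ (1 + δ) / φ s < |l| + 1 :=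
    hl.eventually (gt_mem_nhds (by linarith [le_abs_self l]))
  obtain ⟨ε, hε, hsub⟩ := mem_nhdsGT_iff_exists_Ioc_subset.1 hev
  refine ⟨max δ (a / 2), lt_max_of_lt_right (by linarith), max_lt hδ (by linarith), |l| + 1,
    by positivity, min ε 1, lt_min hε one_pos, fun s hs hle => ?_⟩
  have h1 : s ^ (1 + δ) / φ s < |l| + 1 := hsub ⟨hs, hle.trans (min_le_left _ _)⟩
  have hs1 : s ≤ 1 := hle.trans (min_le_right _ _)
  have h2 : 1 / φ s = s ^ (1 + δ) / φ s * s ^ (-(1 + δ)) := by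
    rw [Real.rpow_neg hs.le]
    have := (Real.rpow_pos_of_pos hs (1 + δ)).ne'
    field_simp
  rw [h2]
  calc _ ≤ (|l| + 1) * s ^ (-(1 + δ)) :=
        mul_le_mul_of_nonneg_right h1.le (Real.rpow_nonneg hs.le _)
    _ ≤ _ := mul_le_mul_of_nonneg_left (Real.rpow_le_rpow_of_exponent_ge hs hs1
        (by linarith [le_max_left δ (a / 2)])) (by positivity)

theorem exists_of_deltaInfty_lt (hp : ∀ s ∈ Ioi (0 : ℝ), 0 < φ s) {a : ℝ}
    (h : deltaInfty φ < (a : EReal)) :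
    ∃ δ : ℝ, δ < a ∧ ∀ᶠ s in atTop, φ s ≤ s ^ (1 + δ) := by
  obtain ⟨_, ⟨δ, hl, rfl⟩, hδ⟩ := sInf_lt_iff.1 h
  replace hδ : δ < a := EReal.coe_lt_coe_iff.1 hδ
  refine ⟨δ, hδ, ?_⟩
  filter_upwards [hl.eventually (eventually_ge_atTop 1), eventually_gt_atTop 0] with s h1 h2
  rwa [le_div_iff₀ (hp s h2), one_mul] at h1

/-- The growth condition at `0` bounds the `φ`-logarithm near `0` by a power. -/
theorem exists_lnPhi_sub_le (hm : MonotoneOn φ (Ioi 0)) (hp : ∀ s ∈ Ioi (0 : ℝ), 0 < φ s)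
    (hc : ContinuousOn φ (Ioi 0)) {δ C s₀ : ℝ} (hδ : 0 < δ) (hC : 0 ≤ C) (hs₀ : 0 < s₀)
    (hb : ∀ s, 0 < s → s ≤ s₀ → 1 / φ s ≤ C * s ^ (-(1 + δ))) {M : ℝ}
    (hM : 0 < M) : ∃ K : ℝ, 0 ≤ K ∧ ∀ s, 0 < s → s ≤ M → lnPhi φ M - lnPhi φ s ≤ K * s ^ (-δ) := by
  have hφ₀ := hp s₀ hs₀
  obtain ⟨C', hC', hb'⟩ : ∃ C' : ℝ, 0 ≤ C' ∧
      ∀ s, 0 < s → s ≤ M → 1 / φ s ≤ C' * s ^ (-(1 + δ)) := by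
    refine ⟨max C (1 / φ s₀ * M ^ (1 + δ)), le_max_of_le_left hC, fun s hs hsM => ?_⟩
    rcases le_total s s₀ with h | h
    · exact (hb s hs h).trans (mul_le_mul_of_nonneg_right (le_max_left _ _)
        (Real.rpow_nonneg hs.le _))
    · have h1 : 1 / φ s ≤ 1 / φ s₀ := one_div_le_one_div_of_le hφ₀ (hm hs₀ hs h)
      have h2 : (1 : ℝ) ≤ M ^ (1 + δ) * s ^ (-(1 + δ)) := by
        rw [Real.rpow_neg hs.le, ← div_eq_mul_inv, one_le_div (Real.rpow_pos_of_pos hs _)]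
        exact Real.rpow_le_rpow hs.le hsM (by linarith)
      calc 1 / φ s ≤ 1 / φ s₀ * (M ^ (1 + δ) * s ^ (-(1 + δ))) :=
            h1.trans (le_mul_of_one_le_right (by positivity) h2)
        _ = 1 / φ s₀ * M ^ (1 + δ) * s ^ (-(1 + δ)) := by ring
        _ ≤ _ := mul_le_mul_of_nonneg_right (le_max_right _ _) (Real.rpow_nonneg hs.le _)
  refine ⟨C' / δ, by positivity, fun s hs hsM => ?_⟩
  have h0 : (0 : ℝ) ∉ uIcc s M := fun h => by
    rw [uIcc_of_le hsM] at h; exact absurd h.1 (not_le.2 hs)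
  rw [lnPhi_sub hp hc hs hM]
  have hint : IntervalIntegrable (fun x : ℝ => x ^ (-(1 + δ))) volume s M :=
    intervalIntegral.intervalIntegrable_rpow (Or.inr h0)
  calc ∫ x in s..M, 1 / φ x ≤ ∫ x in s..M, C' * x ^ (-(1 + δ)) :=
        intervalIntegral.integral_mono_on hsM (intervalIntegrable_one_div hp hc hs hM)
          (hint.const_mul C') fun x hx => hb' x (hs.trans_le hx.1) hx.2
    _ = C' * ((M ^ (-δ) - s ^ (-δ)) / (-δ)) := by
        rw [intervalIntegral.integral_const_mul, integral_rpow (Or.inr ⟨by linarith, h0⟩)]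
        congr 2 <;> ring_nf
    _ ≤ C' / δ * s ^ (-δ) := by
        have : 0 ≤ C' / δ * M ^ (-δ) := mul_nonneg (by positivity) (Real.rpow_nonneg hM.le _)
        have e : C' * ((M ^ (-δ) - s ^ (-δ)) / (-δ)) =
            C' / δ * s ^ (-δ) - C' / δ * M ^ (-δ) := by field_simp; ring
        linarith

/-! ### Moments of the profile as functions of its height -/

/-- The excess of `ln_φ M` over `ln_φ s`, cut off at `0`. Up to scaling, it is the squared radius
at which the profile of height `M` takes the value `s`. -/
def excess (φ : ℝ → ℝ) (M s : ℝ) : ℝ := max (lnPhi φ M - lnPhi φ s) 0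

/-- The integral of the `r`-th power of the excess. For `r = d / 2` and `r = d / 2 + 1` it is, up
to constants, the mass and the second moment of the profile of height `M`. -/
def excessMoment (φ : ℝ → ℝ) (r M : ℝ) : ℝ := ∫ s in Ioi (0 : ℝ), excess φ M s ^ r

theorem excess_nonneg (φ : ℝ → ℝ) (M s : ℝ) : 0 ≤ excess φ M s := le_max_right _ _

theorem excess_antitone (hp : ∀ s ∈ Ioi (0 : ℝ), 0 < φ s) (hc : ContinuousOn φ (Ioi 0)) (M : ℝ) :
    AntitoneOn (excess φ M) (Ioi 0) := fun _ ha _ hb hab =>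
  max_le_max_right _ (sub_le_sub_left ((strictMonoOn_lnPhi hp hc).monotoneOn ha hb hab) _)

theorem excess_mono (hp : ∀ s ∈ Ioi (0 : ℝ), 0 < φ s) (hc : ContinuousOn φ (Ioi 0)) {M N : ℝ}
    (hM : 0 < M) (hMN : M ≤ N) (s : ℝ) : excess φ M s ≤ excess φ N s :=
  max_le_max_right _ (sub_le_sub_right
    ((strictMonoOn_lnPhi hp hc).monotoneOn hM (hM.trans_le hMN) hMN) _)

theorem excess_eq_zero (hp : ∀ s ∈ Ioi (0 : ℝ), 0 < φ s) (hc : ContinuousOn φ (Ioi 0)) {M s : ℝ}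
    (hM : 0 < M) (hs : M ≤ s) : excess φ M s = 0 :=
  max_eq_right (sub_nonpos.2
    ((strictMonoOn_lnPhi hp hc).monotoneOn hM (hM.trans_le hs) hs))

theorem excess_pos (hp : ∀ s ∈ Ioi (0 : ℝ), 0 < φ s) (hc : ContinuousOn φ (Ioi 0)) {M s : ℝ}
    (hs : 0 < s) (hsM : s < M) : 0 < excess φ M s :=
  lt_max_of_lt_left (sub_pos.2 (strictMonoOn_lnPhi hp hc hs (hs.trans hsM) hsM))

theorem aestronglyMeasurable_excess (hp : ∀ s ∈ Ioi (0 : ℝ), 0 < φ s)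
    (hc : ContinuousOn φ (Ioi 0)) (M r : ℝ) :
    AEStronglyMeasurable (fun s => excess φ M s ^ r) (volume.restrict (Ioi 0)) := by
  have h : ContinuousOn (fun s => excess φ M s) (Ioi 0) :=
    ContinuousOn.sup (continuousOn_const.sub (continuousOn_lnPhi hp hc)) continuousOn_const
  exact (h.aestronglyMeasurable measurableSet_Ioi).aemeasurable.pow_const r |>.aestronglyMeasurable

theorem integrableOn_excess (hm : MonotoneOn φ (Ioi 0)) (hp : ∀ s ∈ Ioi (0 : ℝ), 0 < φ s)
    (hc : ContinuousOn φ (Ioi 0)) {δ C s₀ : ℝ} (hδ : 0 < δ) (hC : 0 ≤ C) (hs₀ : 0 < s₀)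
    (hb : ∀ s, 0 < s → s ≤ s₀ → 1 / φ s ≤ C * s ^ (-(1 + δ))) {r : ℝ} (hr : 0 < r)
    (hrδ : r * δ < 1) {M : ℝ} (hM : 0 < M) :
    IntegrableOn (fun s => excess φ M s ^ r) (Ioi 0) := by
  obtain ⟨K, hK, hKb⟩ := exists_lnPhi_sub_le hm hp hc hδ hC hs₀ hb hM
  have hdom : IntegrableOn (fun s : ℝ => K ^ r * s ^ (-(δ * r))) (Ioc 0 M) := by
    have := (intervalIntegral.intervalIntegrable_rpow' (a := 0) (b := M) (r := -(δ * r))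
      (by linarith [mul_comm r δ])).const_mul (K ^ r)
    rwa [intervalIntegrable_iff_integrableOn_Ioc_of_le hM.le] at this
  have hae := aestronglyMeasurable_excess hp hc M r
  rw [← Ioc_union_Ioi_eq_Ioi hM.le]
  refine IntegrableOn.union ?_ ?_
  · refine Integrable.mono' hdom (hae.mono_set Ioc_subset_Ioi_self) ?_
    refine (ae_restrict_iff' measurableSet_Ioc).2 (Eventually.of_forall fun s hs => ?_)
    have h1 : excess φ M s ≤ K * s ^ (-δ) :=
      max_le (hKb s hs.1 hs.2) (mul_nonneg hK (Real.rpow_nonneg hs.1.le _))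
    rw [Real.norm_of_nonneg (Real.rpow_nonneg (excess_nonneg _ _ _) _)]
    calc excess φ M s ^ r ≤ (K * s ^ (-δ)) ^ r :=
          Real.rpow_le_rpow (excess_nonneg _ _ _) h1 hr.le
      _ = K ^ r * s ^ (-(δ * r)) := by
          rw [Real.mul_rpow hK (Real.rpow_nonneg hs.1.le _), ← Real.rpow_mul hs.1.le, neg_mul]
  · refine IntegrableOn.congr_fun (f := fun _ => (0 : ℝ)) integrableOn_zero (fun s hs => ?_)
      measurableSet_Ioi
    rw [excess_eq_zero hp hc hM (le_of_lt hs), Real.zero_rpow hr.ne']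

theorem excessMoment_nonneg (φ : ℝ → ℝ) (r M : ℝ) : 0 ≤ excessMoment φ r M :=
  integral_nonneg fun _ => Real.rpow_nonneg (excess_nonneg _ _ _) _

theorem mul_excess_rpow_le (hp : ∀ s ∈ Ioi (0 : ℝ), 0 < φ s) (hc : ContinuousOn φ (Ioi 0))
    {r M s : ℝ} (hr : 0 < r) (hI : IntegrableOn (fun s => excess φ M s ^ r) (Ioi 0))
    (hs : 0 < s) : s * excess φ M s ^ r ≤ excessMoment φ r M := by
  calc s * excess φ M s ^ r = ∫ _ in Ioc 0 s, excess φ M s ^ r := by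
        rw [setIntegral_const, Real.volume_real_Ioc_of_le hs.le, smul_eq_mul, sub_zero]
    _ ≤ ∫ t in Ioc 0 s, excess φ M t ^ r :=
        setIntegral_mono_on (integrableOn_const (by simp)) (hI.mono_set Ioc_subset_Ioi_self)
          measurableSet_Ioc fun t ht => Real.rpow_le_rpow (excess_nonneg _ _ _)
            (excess_antitone hp hc M ht.1 (mem_Ioi.2 hs) ht.2) hr.le
    _ ≤ _ := setIntegral_mono_set hI
        (Eventually.of_forall fun _ => Real.rpow_nonneg (excess_nonneg _ _ _) _)
        (Eventually.of_forall Ioc_subset_Ioi_self)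

theorem excessMoment_pos (hp : ∀ s ∈ Ioi (0 : ℝ), 0 < φ s) (hc : ContinuousOn φ (Ioi 0))
    {r M : ℝ} (hr : 0 < r) (hI : IntegrableOn (fun s => excess φ M s ^ r) (Ioi 0))
    (hM : 0 < M) : 0 < excessMoment φ r M := by
  have h := mul_excess_rpow_le hp hc hr hI (half_pos hM)
  have := Real.rpow_pos_of_pos (excess_pos hp hc (half_pos hM) (half_lt_self hM)) r
  exact lt_of_lt_of_le (by positivity) h

theorem continuousOn_excessMoment (hp : ∀ s ∈ Ioi (0 : ℝ), 0 < φ s) (hc : ContinuousOn φ (Ioi 0))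
    {r : ℝ} (hr : 0 < r)
    (hI : ∀ M, 0 < M → IntegrableOn (fun s => excess φ M s ^ r) (Ioi 0)) :
    ContinuousOn (excessMoment φ r) (Ioi 0) := by
  intro M hM
  have hM0 : (0 : ℝ) < M := hM
  refine ContinuousAt.continuousWithinAt ?_
  refine continuousAt_of_dominated (bound := fun s => excess φ (2 * M) s ^ r)
    (Eventually.of_forall fun N => aestronglyMeasurable_excess hp hc N r) ?_
    (hI (2 * M) (by linarith)) ?_
  · filter_upwards [Ioo_mem_nhds hM0 (show M < 2 * M by linarith)] with N hN
    refine Eventually.of_forall fun s => ?_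
    rw [Real.norm_of_nonneg (Real.rpow_nonneg (excess_nonneg _ _ _) _)]
    exact Real.rpow_le_rpow (excess_nonneg _ _ _) (excess_mono hp hc hN.1 hN.2.le s) hr.le
  · refine Eventually.of_forall fun s => ?_
    have h1 : ContinuousAt (lnPhi φ) M := (continuousOn_lnPhi hp hc).continuousAt (Ioi_mem_nhds hM0)
    exact ((h1.sub continuousAt_const).sup continuousAt_const).rpow_const (Or.inr hr.le)

/-- Low profiles are spread out: for a given mass, the second moment is large. -/
theorem exists_lt_excessMoment (hp : ∀ s ∈ Ioi (0 : ℝ), 0 < φ s) (hc : ContinuousOn φ (Ioi 0))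
    {q : ℝ} (hq : 0 < q)
    (hI : ∀ M, 0 < M → IntegrableOn (fun s => excess φ M s ^ q) (Ioi 0))
    (hI' : ∀ M, 0 < M → IntegrableOn (fun s => excess φ M s ^ (q + 1)) (Ioi 0))
    {κ : ℝ} (hκ : 0 < κ) :
    ∃ M, 0 < M ∧ κ * excessMoment φ q M ^ (1 + 1 / q) < excessMoment φ (q + 1) M := by
  have hk : 0 < (2 * κ) ^ q := Real.rpow_pos_of_pos (by linarith) q
  refine ⟨1 / (4 * (2 * κ) ^ q), by positivity, ?_⟩
  set M := 1 / (4 * (2 * κ) ^ q) with hMdef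
  have hM : 0 < M := by positivity
  by_contra! hcon
  have hJ := excessMoment_pos hp hc hq (hI M hM) hM
  set J := excessMoment φ q M with hJdef
  have hJq : 0 < J ^ (1 / q) := Real.rpow_pos_of_pos hJ _
  -- below the threshold `a` the excess is bounded by `a`, above it by its product with `h / a`
  set a := 2 * κ * J ^ (1 / q) with hadef
  have ha : 0 < a := by positivity
  have haq : a ^ q = (2 * κ) ^ q * J := by
    rw [hadef, Real.mul_rpow (by positivity) hJq.le, ← Real.rpow_mul hJ.le,
      one_div_mul_cancel hq.ne', Real.rpow_one]
  have hpt : ∀ s ∈ Ioi (0 : ℝ), excess φ M s ^ q ≤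
      (Ioc 0 M).indicator (fun _ => a ^ q) s + excess φ M s ^ (q + 1) / a := by
    intro s hs
    have h0 := excess_nonneg φ M s
    have h1 : 0 ≤ excess φ M s ^ (q + 1) / a := div_nonneg (Real.rpow_nonneg h0 _) ha.le
    by_cases hsM : s ≤ M
    · rw [indicator_of_mem (show s ∈ Ioc 0 M from ⟨hs, hsM⟩)]
      rcases le_total (excess φ M s) a with h | h
      · exact (Real.rpow_le_rpow h0 h hq.le).trans (le_add_of_nonneg_right h1)
      · refine le_trans ?_ (le_add_of_nonneg_left (Real.rpow_nonneg ha.le _))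
        rw [le_div_iff₀ ha, Real.rpow_add_one (ha.trans_le h).ne']
        exact mul_le_mul_of_nonneg_left h (Real.rpow_nonneg h0 _)
    · rw [excess_eq_zero hp hc hM (not_le.1 hsM).le, Real.zero_rpow hq.ne',
        Real.zero_rpow (by linarith), zero_div, add_zero]
      exact indicator_nonneg (fun _ _ => Real.rpow_nonneg ha.le _) _
  have hind : IntegrableOn ((Ioc 0 M).indicator fun _ => a ^ q) (Ioi (0 : ℝ)) :=
    ((integrable_indicator_iff measurableSet_Ioc).2
      (integrableOn_const (by simp))).integrableOn
  have hle : J ≤ a ^ q * M + excessMoment φ (q + 1) M / a := by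
    calc J ≤ ∫ s in Ioi (0 : ℝ), ((Ioc 0 M).indicator (fun _ => a ^ q) s +
          excess φ M s ^ (q + 1) / a) :=
          setIntegral_mono_on (hI M hM) (hind.add ((hI' M hM).div_const a)) measurableSet_Ioi hpt
      _ = _ := by
          rw [integral_add hind ((hI' M hM).div_const a), integral_div,
            setIntegral_indicator measurableSet_Ioc, inter_eq_right.2 Ioc_subset_Ioi_self,
            setIntegral_const, Real.volume_real_Ioc_of_le hM.le, smul_eq_mul, sub_zero, mul_comm]
          rfl
  have h2 : excessMoment φ (q + 1) M / a ≤ J / 2 := by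
    rw [div_le_iff₀ ha]
    refine hcon.trans_eq ?_
    rw [Real.rpow_add hJ, Real.rpow_one, hadef]
    ring
  have h3 : a ^ q * M = J / 4 := by
    rw [haq, hMdef]; field_simp
  linarith

/-- For high profiles the mass outgrows the corresponding power of the height. -/
theorem exists_mul_rpow_le_excessMoment (hm : MonotoneOn φ (Ioi 0))
    (hp : ∀ s ∈ Ioi (0 : ℝ), 0 < φ s) (hc : ContinuousOn φ (Ioi 0))
    {q : ℝ} (hq : 0 < q)
    (hI : ∀ M, 0 < M → IntegrableOn (fun s => excess φ M s ^ q) (Ioi 0))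
    {δ : ℝ} (hδ : q * δ < 1) (hinf : ∀ᶠ s in atTop, φ s ≤ s ^ (1 + δ)) (N : ℝ) :
    ∃ M, 2 ≤ M ∧ N * lnPhi φ M ^ q ≤ excessMoment φ q M := by
  have hmono := strictMonoOn_lnPhi hp hc
  have h2 : 0 < lnPhi φ 2 := by
    have := hmono (mem_Ioi.2 one_pos) (mem_Ioi.2 two_pos) one_lt_two
    rwa [lnPhi_one] at this
  by_cases hB : ∃ B, ∀ t, 0 < t → lnPhi φ t ≤ B
  · obtain ⟨B, hB⟩ := hB
    have hlim : Tendsto (fun M : ℝ => M ^ (1 - q * δ) * (2 * 2 ^ q)⁻¹) atTop atTop :=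
      (tendsto_rpow_atTop (by linarith)).atTop_mul_const (by positivity)
    obtain ⟨M, hM1, hM2, hM3⟩ := (hinf.and ((eventually_ge_atTop 2).and
      (hlim.eventually (eventually_ge_atTop (|N| * B ^ q))))).exists
    have hM : 0 < M := by linarith
    refine ⟨M, hM2, ?_⟩
    have hl : 0 ≤ lnPhi φ M :=
      h2.le.trans (hmono.monotoneOn (mem_Ioi.2 two_pos) hM hM2)
    have hex : M ^ (-δ) / 2 ≤ excess φ M (M / 2) := by
      refine le_max_of_le_left (le_trans ?_ (div_le_lnPhi_sub hm hp hc (half_pos hM) (by linarith)))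
      have e : M ^ (-δ) / 2 = (M - M / 2) / M ^ (1 + δ) := by
        rw [Real.rpow_add hM, Real.rpow_one, Real.rpow_neg hM.le]
        have := (Real.rpow_pos_of_pos hM δ).ne'
        field_simp; ring
      rw [e]
      exact div_le_div_of_nonneg_left (by linarith) (hp M hM) hM1
    have hpw := (Real.rpow_pos_of_pos hM (-δ)).le
    calc N * lnPhi φ M ^ q ≤ |N| * B ^ q :=
          mul_le_mul (le_abs_self N) (Real.rpow_le_rpow hl (hB M hM) hq.le)
            (Real.rpow_nonneg hl _) (abs_nonneg _)
      _ ≤ M ^ (1 - q * δ) * (2 * 2 ^ q)⁻¹ := hM3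
      _ = M / 2 * (M ^ (-δ) / 2) ^ q := by
          rw [Real.div_rpow hpw zero_le_two, ← Real.rpow_mul hM.le, sub_eq_add_neg,
            Real.rpow_add hM, Real.rpow_one, show -δ * q = -(q * δ) by ring]
          have : (0 : ℝ) < 2 ^ q := by positivity
          field_simp
      _ ≤ M / 2 * excess φ M (M / 2) ^ q := mul_le_mul_of_nonneg_left
          (Real.rpow_le_rpow (by positivity) hex hq.le) (by linarith)
      _ ≤ _ := mul_excess_rpow_le hp hc hq (hI M hM) (half_pos hM)
  · push Not at hB
    set S := 2 ^ q * |N| + 1 with hS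
    have hS0 : 0 < S := by positivity
    obtain ⟨M, hM, hMB⟩ := hB (max (2 * lnPhi φ S) (lnPhi φ 2))
    have hMS : 2 * lnPhi φ S < lnPhi φ M := (le_max_left _ _).trans_lt hMB
    have hM2 : lnPhi φ 2 < lnPhi φ M := (le_max_right _ _).trans_lt hMB
    have hl : 0 < lnPhi φ M := h2.trans hM2
    refine ⟨M, ((hmono.lt_iff_lt (mem_Ioi.2 two_pos) hM).1 hM2).le, ?_⟩
    have hex : lnPhi φ M / 2 ≤ excess φ M S := le_max_of_le_left (by linarith)
    have hlq : 0 < lnPhi φ M ^ q := Real.rpow_pos_of_pos hl q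
    calc N * lnPhi φ M ^ q ≤ (S / 2 ^ q) * lnPhi φ M ^ q := by
          refine mul_le_mul_of_nonneg_right ?_ hlq.le
          rw [le_div_iff₀ (by positivity), hS]
          have : (0 : ℝ) < 2 ^ q := by positivity
          nlinarith [le_abs_self N]
      _ = S * (lnPhi φ M / 2) ^ q := by
          rw [Real.div_rpow hl.le zero_le_two]; ring
      _ ≤ S * excess φ M S ^ q := mul_le_mul_of_nonneg_left
          (Real.rpow_le_rpow (by positivity) hex hq.le) hS0.le
      _ ≤ _ := mul_excess_rpow_le hp hc hq (hI M hM) hS0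

/-- High profiles are concentrated: for a given mass, the second moment is small. The part of the
moment above the level `K` is controlled by the mass since the excess is decreasing, and the part
below `K` by a power of the height of the profile, which the mass outgrows. -/
theorem exists_excessMoment_le (hm : MonotoneOn φ (Ioi 0))
    (hp : ∀ s ∈ Ioi (0 : ℝ), 0 < φ s) (hc : ContinuousOn φ (Ioi 0))
    {q : ℝ} (hq : 0 < q)
    (hI : ∀ M, 0 < M → IntegrableOn (fun s => excess φ M s ^ q) (Ioi 0))
    (hI' : ∀ M, 0 < M → IntegrableOn (fun s => excess φ M s ^ (q + 1)) (Ioi 0))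
    {δ : ℝ} (hδ : q * δ < 1) (hinf : ∀ᶠ s in atTop, φ s ≤ s ^ (1 + δ)) {ε : ℝ} (hε : 0 < ε) :
    ∃ M, 0 < M ∧ excessMoment φ (q + 1) M ≤ ε * excessMoment φ q M ^ (1 + 1 / q) := by
  have hmono := strictMonoOn_lnPhi hp hc
  have h2 : 0 < lnPhi φ 2 := by
    have := hmono (mem_Ioi.2 one_pos) (mem_Ioi.2 two_pos) one_lt_two
    rwa [lnPhi_one] at this
  have he : 0 < 1 + 1 / q := by positivity
  have hqe : q * (1 + 1 / q) = q + 1 := by field_simp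
  set K : ℝ := (2 / ε) ^ q with hKdef
  have hK : 0 < K := Real.rpow_pos_of_pos (by positivity) q
  have hKε : K ^ (1 / q) = 2 / ε := by
    rw [hKdef, ← Real.rpow_mul (by positivity), mul_one_div_cancel hq.ne', Real.rpow_one]
  set B := 2 ^ q * (K + excessMoment φ (q + 1) 1 / lnPhi φ 2 ^ (q + 1)) with hBdef
  have hB : 0 ≤ B := by
    have := excessMoment_nonneg φ (q + 1) 1
    have := Real.rpow_pos_of_pos h2 (q + 1)
    positivity
  set N := (2 * B / ε) ^ (1 / (1 + 1 / q)) with hN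
  have hN0 : 0 ≤ N := Real.rpow_nonneg (by positivity) _
  have hNe : N ^ (1 + 1 / q) = 2 * B / ε := by
    rw [hN, ← Real.rpow_mul (by positivity), one_div_mul_cancel he.ne', Real.rpow_one]
  obtain ⟨M, hM2, hMN⟩ := exists_mul_rpow_le_excessMoment hm hp hc hq hI hδ hinf N
  have hM : 0 < M := by linarith
  refine ⟨M, hM, ?_⟩
  have hl2 : lnPhi φ 2 ≤ lnPhi φ M := hmono.monotoneOn (mem_Ioi.2 two_pos) hM hM2
  have hl : 0 < lnPhi φ M := h2.trans_le hl2
  set L := lnPhi φ M with hL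
  set J := excessMoment φ q M with hJdef
  have hJ : 0 < J := excessMoment_pos hp hc hq (hI M hM) hM
  have hlow : ∫ s in Ioc 0 K, excess φ M s ^ (q + 1) ≤ ε / 2 * J ^ (1 + 1 / q) := by
    have hpt : ∀ s ∈ Ioc 0 K, excess φ M s ^ (q + 1) ≤
        2 ^ q * (L ^ (q + 1) + excess φ 1 s ^ (q + 1)) := by
      intro s hs
      have h3 : excess φ M s ≤ L + excess φ 1 s := by
        refine max_le ?_ (add_nonneg hl.le (excess_nonneg _ _ _))
        have : lnPhi φ 1 - lnPhi φ s ≤ excess φ 1 s := le_max_left _ _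
        rw [lnPhi_one] at this
        linarith
      refine (Real.rpow_le_rpow (excess_nonneg _ _ _) h3 (by linarith)).trans ?_
      have := NNReal.rpow_add_le_mul_rpow_add_rpow ⟨L, hl.le⟩ ⟨excess φ 1 s, excess_nonneg φ 1 s⟩
        (show 1 ≤ q + 1 by linarith)
      rw [add_sub_cancel_right] at this
      exact_mod_cast this
    have i1 : IntegrableOn (fun s => excess φ 1 s ^ (q + 1)) (Ioc 0 K) :=
      (hI' 1 one_pos).mono_set Ioc_subset_Ioi_self
    have i0 : IntegrableOn (fun _ : ℝ => L ^ (q + 1)) (Ioc 0 K) := integrableOn_const (by simp)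
    have h4 : ∫ s in Ioc 0 K, excess φ 1 s ^ (q + 1) ≤ excessMoment φ (q + 1) 1 :=
      setIntegral_mono_set (hI' 1 one_pos)
        (Eventually.of_forall fun _ => Real.rpow_nonneg (excess_nonneg _ _ _) _)
        (Eventually.of_forall Ioc_subset_Ioi_self)
    have h5 : excessMoment φ (q + 1) 1 ≤
        excessMoment φ (q + 1) 1 / lnPhi φ 2 ^ (q + 1) * L ^ (q + 1) := by
      have a1 := Real.rpow_pos_of_pos h2 (q + 1)
      rw [div_mul_eq_mul_div, le_div_iff₀ a1]
      exact mul_le_mul_of_nonneg_left (Real.rpow_le_rpow h2.le hl2 (by linarith))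
        (excessMoment_nonneg _ _ _)
    calc ∫ s in Ioc 0 K, excess φ M s ^ (q + 1)
        ≤ ∫ s in Ioc 0 K, 2 ^ q * (L ^ (q + 1) + excess φ 1 s ^ (q + 1)) :=
          setIntegral_mono_on ((hI' M hM).mono_set Ioc_subset_Ioi_self)
            ((i0.add i1).const_mul _) measurableSet_Ioc hpt
      _ = 2 ^ q * (K * L ^ (q + 1) + ∫ s in Ioc 0 K, excess φ 1 s ^ (q + 1)) := by
          rw [integral_const_mul, integral_add i0 i1, setIntegral_const,
            Real.volume_real_Ioc_of_le hK.le, smul_eq_mul, sub_zero]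
      _ ≤ 2 ^ q * (K * L ^ (q + 1) +
          excessMoment φ (q + 1) 1 / lnPhi φ 2 ^ (q + 1) * L ^ (q + 1)) :=
          mul_le_mul_of_nonneg_left (by linarith) (by positivity)
      _ = ε / 2 * (N ^ (1 + 1 / q) * L ^ (q + 1)) := by
          rw [hNe, hBdef]; field_simp
      _ = ε / 2 * (N * L ^ q) ^ (1 + 1 / q) := by
          rw [Real.mul_rpow hN0 (Real.rpow_nonneg hl.le _), ← Real.rpow_mul hl.le, hqe]
      _ ≤ _ := mul_le_mul_of_nonneg_left (Real.rpow_le_rpow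
          (mul_nonneg hN0 (Real.rpow_nonneg hl.le _)) hMN he.le) (by positivity)
  have hhigh : ∫ s in Ioi K, excess φ M s ^ (q + 1) ≤ ε / 2 * J ^ (1 + 1 / q) := by
    have hpt : ∀ s ∈ Ioi K, excess φ M s ^ (q + 1) ≤ (J / K) ^ (1 / q) * excess φ M s ^ q := by
      intro s hs
      have hs0 : 0 < s := hK.trans hs
      have h0 := excess_nonneg φ M s
      have h3 : excess φ M s ≤ (J / K) ^ (1 / q) := by
        have h4 : excess φ M s ^ q ≤ J / K := by
          rw [le_div_iff₀ hK, mul_comm]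
          exact (mul_le_mul_of_nonneg_right (le_of_lt hs) (Real.rpow_nonneg h0 _)).trans
            (mul_excess_rpow_le hp hc hq (hI M hM) hs0)
        have h5 := Real.rpow_le_rpow (Real.rpow_nonneg h0 _) h4 (by positivity : 0 ≤ 1 / q)
        rwa [← Real.rpow_mul h0, mul_one_div_cancel hq.ne', Real.rpow_one] at h5
      rw [Real.rpow_add' h0 (by linarith), Real.rpow_one, mul_comm]
      exact mul_le_mul_of_nonneg_right h3 (Real.rpow_nonneg h0 _)
    have hsub : Ioi K ⊆ Ioi 0 := Ioi_subset_Ioi hK.le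
    calc ∫ s in Ioi K, excess φ M s ^ (q + 1)
        ≤ ∫ s in Ioi K, (J / K) ^ (1 / q) * excess φ M s ^ q :=
          setIntegral_mono_on ((hI' M hM).mono_set hsub)
            (((hI M hM).mono_set hsub).const_mul _) measurableSet_Ioi hpt
      _ = (J / K) ^ (1 / q) * ∫ s in Ioi K, excess φ M s ^ q := integral_const_mul _ _
      _ ≤ (J / K) ^ (1 / q) * J := mul_le_mul_of_nonneg_left (setIntegral_mono_set (hI M hM)
          (Eventually.of_forall fun _ => Real.rpow_nonneg (excess_nonneg _ _ _) _)
          (Eventually.of_forall hsub)) (Real.rpow_nonneg (by positivity) _)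
      _ = ε / 2 * J ^ (1 + 1 / q) := by
          rw [Real.div_rpow hJ.le hK.le, hKε, Real.rpow_add hJ, Real.rpow_one]
          field_simp
  have hsplit : excessMoment φ (q + 1) M =
      (∫ s in Ioc 0 K, excess φ M s ^ (q + 1)) + ∫ s in Ioi K, excess φ M s ^ (q + 1) := by
    rw [excessMoment, ← Ioc_union_Ioi_eq_Ioi hK.le]
    exact setIntegral_union (Set.Ioc_disjoint_Ioi le_rfl) measurableSet_Ioi
      ((hI' M hM).mono_set Ioc_subset_Ioi_self) ((hI' M hM).mono_set (Ioi_subset_Ioi hK.le))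
  rw [hsplit]
  linarith

/-- The scale-invariant ratio of second moment and mass takes every positive value. -/
theorem exists_excessMoment_eq (hm : MonotoneOn φ (Ioi 0))
    (hp : ∀ s ∈ Ioi (0 : ℝ), 0 < φ s) (hc : ContinuousOn φ (Ioi 0))
    {q : ℝ} (hq : 0 < q)
    (hI : ∀ M, 0 < M → IntegrableOn (fun s => excess φ M s ^ q) (Ioi 0))
    (hI' : ∀ M, 0 < M → IntegrableOn (fun s => excess φ M s ^ (q + 1)) (Ioi 0))
    {δ : ℝ} (hδ : q * δ < 1) (hinf : ∀ᶠ s in atTop, φ s ≤ s ^ (1 + δ)) {κ : ℝ} (hκ : 0 < κ) :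
    ∃ M, 0 < M ∧ excessMoment φ (q + 1) M = κ * excessMoment φ q M ^ (1 + 1 / q) := by
  obtain ⟨M₁, hM₁, h1⟩ := exists_lt_excessMoment hp hc hq hI hI' hκ
  obtain ⟨M₂, hM₂, h2⟩ := exists_excessMoment_le hm hp hc hq hI hI' hδ hinf hκ
  have hcont : ContinuousOn (fun M => excessMoment φ (q + 1) M -
      κ * excessMoment φ q M ^ (1 + 1 / q)) (Ioi 0) :=
    (continuousOn_excessMoment hp hc (by linarith) hI').sub
      (((continuousOn_excessMoment hp hc hq hI).rpow_const
        fun M _ => Or.inr (by positivity)).const_smul κ)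
  obtain ⟨M, hM, h⟩ := isPreconnected_Ioi.intermediate_value (mem_Ioi.2 hM₂) (mem_Ioi.2 hM₁) hcont
    (show (0 : ℝ) ∈ Icc _ _ from ⟨by linarith, by linarith⟩)
  exact ⟨M, hM, by linarith [show excessMoment φ (q + 1) M -
      κ * excessMoment φ q M ^ (1 + 1 / q) = 0 from h]⟩

end

/-! ### Existence of a standard pair -/

section

variable {d : ℕ} {φ : ℝ → ℝ}

theorem phiGaussian_zero_one (φ : ℝ → ℝ) (lam c : ℝ) :
    phiGaussian φ lam c (0 : Eucl d) 1 =
      (volume : Measure (Eucl d)).withDensity fun x => expPhi φ (lam - c * ‖x‖ ^ 2) := by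
  unfold phiGaussian
  congr 1
  funext x
  have : (x - 0).ofLp ⬝ᵥ ((1 : Matrix (Fin d) (Fin d) ℝ)⁻¹ *ᵥ (x - 0).ofLp) = ‖x‖ ^ 2 := by
    rw [sub_zero, inv_one, Matrix.one_mulVec, EuclideanSpace.real_norm_sq_eq]
    exact Finset.sum_congr rfl fun i _ => (sq _).symm
  rw [this]
  simp

theorem measurable_radial_expPhi (hp : ∀ s ∈ Ioi (0 : ℝ), 0 < φ s) (hc : ContinuousOn φ (Ioi 0))
    (lam c : ℝ) : Measurable fun x : Eucl d => expPhi φ (lam - c * ‖x‖ ^ 2) :=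
  (monotone_expPhi hp hc).measurable.comp (by fun_prop)

theorem map_affMap_phiGaussian_orthogonal (φ : ℝ → ℝ) (lam c : ℝ)
    {A : Matrix (Fin d) (Fin d) ℝ} (hA : A * Aᵀ = 1) :
    (phiGaussian φ lam c (0 : Eucl d) 1).map (affMap 0 0 A) = phiGaussian φ lam c 0 1 := by
  rw [map_affMap_phiGaussian, mul_one, hA]
  exact (Matrix.isUnit_iff_isUnit_det A).1 (IsUnit.of_mul_eq_one _ hA)

/-- The profile is invariant under orthogonal maps. Hence it suffices to normalize its mass and
its second moment for it to have mean `0` and identity covariance matrix. -/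
theorem hasMeanCov_phiGaussian_zero_one (hd : 0 < d) {lam c : ℝ}
    (h1 : IsProbabilityMeasure (phiGaussian φ lam c (0 : Eucl d) 1))
    (h2 : ∫⁻ x, ENNReal.ofReal (‖x‖ ^ 2) ∂(phiGaussian φ lam c (0 : Eucl d) 1) =
      ENNReal.ofReal d) :
    HasMeanCov (phiGaussian φ lam c (0 : Eucl d) 1) 0 1 := by
  have hinv := fun (A : Matrix (Fin d) (Fin d) ℝ) (hA : A * Aᵀ = 1) =>
    map_affMap_phiGaussian_orthogonal φ lam c hA
  set μ := phiGaussian φ lam c (0 : Eucl d) 1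
  have hsq : Integrable (fun x : Eucl d => ‖x‖ ^ 2) μ := by
    refine ⟨by fun_prop, ?_⟩
    rw [hasFiniteIntegral_iff_ofReal (Eventually.of_forall fun x => by positivity), h2]
    exact ENNReal.ofReal_lt_top
  have hP : InP2 μ := ⟨h1, (memLp_two_iff_integrable_sq_norm (by fun_prop)).2 hsq⟩
  have hnorm : ∫ x, ‖x‖ ^ 2 ∂μ = d := by
    rw [integral_eq_lintegral_of_nonneg_ae (Eventually.of_forall fun x => by positivity)
      (by fun_prop), h2, ENNReal.toReal_ofReal (by positivity)]
  have hint : ∀ A : Matrix (Fin d) (Fin d) ℝ, A * Aᵀ = 1 → ∀ i j,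
      ∫ x : Eucl d, x i * x j ∂μ = ∫ x : Eucl d, (A *ᵥ x.ofLp) i * (A *ᵥ x.ofLp) j ∂μ := by
    intro A hA i j
    conv_lhs => rw [← hinv A hA]
    rw [integral_map (continuous_affMap _ _ _).aemeasurable (by fun_prop)]
    refine integral_congr_ae (Eventually.of_forall fun x => ?_)
    simp only [affMap, zero_add, sub_zero, matCLM, ofLp_toEuclideanCLM]
  have hmean : ∫ x, x ∂μ = 0 := by
    have h3 : ∫ x, x ∂μ = ∫ x, -x ∂μ := by
      conv_lhs => rw [← hinv (-1) (by simp)]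
      rw [integral_map (continuous_affMap _ _ _).aemeasurable (by fun_prop)]
      refine integral_congr_ae (Eventually.of_forall fun x => ?_)
      simp [affMap, matCLM]
    rw [integral_neg] at h3
    rw [eq_neg_iff_add_eq_zero, ← two_smul ℝ] at h3
    exact (smul_eq_zero.1 h3).resolve_left two_ne_zero
  -- reflecting one coordinate kills the mixed moments
  have hoff : ∀ i j, i ≠ j → ∫ x : Eucl d, x i * x j ∂μ = 0 := by
    intro i j hij
    have h3 := hint (Matrix.diagonal fun k => if k = i then -1 else 1) (by
      rw [Matrix.diagonal_transpose, Matrix.diagonal_mul_diagonal, ← Matrix.diagonal_one]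
      congr 1; funext k; split_ifs <;> norm_num) i j
    simp only [Matrix.mulVec_diagonal, if_true, if_neg hij.symm, neg_mul, one_mul,
      integral_neg] at h3
    linarith
  -- exchanging two coordinates makes their second moments equal
  have hdiag : ∀ i j, ∫ x : Eucl d, x i * x i ∂μ = ∫ x : Eucl d, x j * x j ∂μ := by
    intro i j
    have h3 := hint ((Equiv.swap i j).permMatrix ℝ) (by
      rw [Matrix.transpose_permMatrix, ← Matrix.permMatrix_mul]
      simp) i i
    simpa [Matrix.permMatrix_mulVec] using h3
  have hone : ∀ i, ∫ x : Eucl d, x i * x i ∂μ = 1 := by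
    intro i
    have hi : ∀ k, Integrable (fun x : Eucl d => x k * x k) μ := fun k =>
      (hP.2.euclidean_apply k).integrable_mul (hP.2.euclidean_apply k)
    have h3 : ∫ x : Eucl d, ‖x‖ ^ 2 ∂μ = ∑ k, ∫ x : Eucl d, x k * x k ∂μ := by
      rw [← integral_finsetSum _ fun k _ => hi k]
      refine integral_congr_ae (Eventually.of_forall fun x => ?_)
      simp only [EuclideanSpace.real_norm_sq_eq]
      exact Finset.sum_congr rfl fun k _ => sq _
    rw [hnorm, Finset.sum_congr rfl fun k _ => hdiag k i, Finset.sum_const, Finset.card_univ,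
      Fintype.card_fin, nsmul_eq_mul] at h3
    have hd0 : (d : ℝ) ≠ 0 := by positivity
    exact (mul_right_eq_self₀.1 h3.symm).resolve_right hd0
  refine ⟨hP, hmean, fun i j => ?_⟩
  simp only [PiLp.zero_apply, sub_zero]
  rcases eq_or_ne i j with rfl | hij
  · rw [hone, Matrix.one_apply_eq]
  · rw [hoff i j hij, Matrix.one_apply_ne hij]

theorem lintegral_norm_pow_phiGaussian (hp : ∀ s ∈ Ioi (0 : ℝ), 0 < φ s)
    (hc : ContinuousOn φ (Ioi 0)) (hd : 0 < d) (k : ℕ) {c M : ℝ} (hc0 : 0 < c)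
    (hI : IntegrableOn (fun s => excess φ M s ^ (((d + k : ℕ) : ℝ) / 2)) (Ioi 0)) :
    ∫⁻ x, ENNReal.ofReal (‖x‖ ^ k) ∂(phiGaussian φ (lnPhi φ M) c (0 : Eucl d) 1) =
      ENNReal.ofReal ((c ^ (((d + k : ℕ) : ℝ) / 2))⁻¹ *
        excessMoment φ (((d + k : ℕ) : ℝ) / 2) M *
        (∫⁻ x in Metric.ball (0 : Eucl d) 1, ENNReal.ofReal (‖x‖ ^ k)).toReal) := by
  have hcr : 0 ≤ (c ^ (((d + k : ℕ) : ℝ) / 2))⁻¹ := inv_nonneg.2 (Real.rpow_nonneg hc0.le _)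
  rw [phiGaussian_zero_one, lintegral_withDensity_eq_lintegral_mul _
    (measurable_radial_expPhi hp hc _ _) (by fun_prop)]
  simp only [Pi.mul_apply]
  rw [lintegral_expPhi_mul hp hc _ _ (by fun_prop)]
  have hex : ∀ s, max (lnPhi φ M - lnPhi φ s) 0 = excess φ M s := fun _ => rfl
  simp_rw [setLIntegral_norm_pow hd k hc0, hex]
  rw [lintegral_mul_const' _ _ (setLIntegral_ball_norm_pow_lt_top k).ne,
    ← ofReal_integral_eq_lintegral_ofReal (hI.const_mul _) (Eventually.of_forall fun s =>
      mul_nonneg hcr (Real.rpow_nonneg (excess_nonneg φ M s) _)), integral_const_mul]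
  rw [ENNReal.ofReal_mul (q := (∫⁻ x in Metric.ball (0 : Eucl d) 1,
      ENNReal.ofReal (‖x‖ ^ k)).toReal) (mul_nonneg hcr (excessMoment_nonneg _ _ _)),
    ENNReal.ofReal_toReal (setLIntegral_ball_norm_pow_lt_top k).ne]
  rfl

theorem exists_isStandardPair (hd : 0 < d) (hφ : φ ∈ OrdClass (2 / ((d : ℝ) + 2))) :
    ∃ lam c : ℝ, IsStandardPair d φ lam c := by
  obtain ⟨hm, hp, hc, hlt⟩ := hφ
  have hd0 : (0 : ℝ) < d := by exact_mod_cast hd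
  obtain ⟨δ, hδ, hδa, C, hC, s₀, hs₀, hb⟩ :=
    exists_of_deltaZero_lt (by positivity) ((le_max_left _ _).trans_lt hlt)
  obtain ⟨δ', hδ', hinf⟩ := exists_of_deltaInfty_lt hp ((le_max_right _ _).trans_lt hlt)
  rw [lt_div_iff₀ (by positivity)] at hδa hδ'
  set q : ℝ := (d : ℝ) / 2 with hqdef
  have hq : 0 < q := by positivity
  have hI' : ∀ M, 0 < M → IntegrableOn (fun s => excess φ M s ^ (q + 1)) (Ioi 0) := fun M hM =>
    integrableOn_excess hm hp hc hδ hC hs₀ hb (by linarith) (by rw [hqdef]; linarith) hM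
  have hI : ∀ M, 0 < M → IntegrableOn (fun s => excess φ M s ^ q) (Ioi 0) := fun M hM =>
    integrableOn_excess hm hp hc hδ hC hs₀ hb hq (by rw [hqdef]; linarith) hM
  have hqδ : q * δ' < 1 := by
    rcases le_or_gt δ' 0 with h | h
    · nlinarith
    · rw [hqdef]; linarith
  have e0 : (((d + 0 : ℕ) : ℝ) / 2) = q := by simp [hqdef]
  have e2 : (((d + 2 : ℕ) : ℝ) / 2) = q + 1 := by push_cast; rw [hqdef]; ring
  set b := fun k : ℕ => (∫⁻ x in Metric.ball (0 : Eucl d) 1, ENNReal.ofReal (‖x‖ ^ k)).toReal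
    with hbdef
  have hb0 : ∀ k, 0 < b k := fun k => ENNReal.toReal_pos (setLIntegral_ball_norm_pow_pos hd k).ne'
    (setLIntegral_ball_norm_pow_lt_top k).ne
  obtain ⟨M, hM, hMeq⟩ := exists_excessMoment_eq hm hp hc hq hI hI' hqδ hinf
    (κ := d * b 0 ^ (1 + 1 / q) / b 2)
    (div_pos (mul_pos hd0 (Real.rpow_pos_of_pos (hb0 0) _)) (hb0 2))
  have hJ := excessMoment_pos hp hc hq (hI M hM) hM
  set J := excessMoment φ q M
  have hbJ : 0 < b 0 * J := mul_pos (hb0 0) hJ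
  -- the scale `c` is fixed by the total mass
  set c := (b 0 * J) ^ (1 / q) with hcdef
  have hc0 : 0 < c := Real.rpow_pos_of_pos hbJ _
  have hcq : c ^ q = b 0 * J := by
    rw [hcdef, ← Real.rpow_mul hbJ.le, one_div_mul_cancel hq.ne', Real.rpow_one]
  have hcp : c ^ (q + 1) = b 0 ^ (1 + 1 / q) * J ^ (1 + 1 / q) := by
    rw [hcdef, ← Real.rpow_mul hbJ.le, ← Real.mul_rpow (hb0 0).le hJ.le]
    congr 1
    field_simp
  have hmono := strictMonoOn_lnPhi hp hc
  refine ⟨lnPhi φ M, c, ?_, ?_, hc0, hasMeanCov_phiGaussian_zero_one hd ⟨?_⟩ ?_⟩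
  · refine lt_of_le_of_lt (iInf₂_le (M / 2) (half_pos hM)) ?_
    exact EReal.coe_lt_coe_iff.2 (hmono (half_pos hM) hM (half_lt_self hM))
  · have h2M : 0 < 2 * M := by linarith
    refine lt_of_lt_of_le ?_ (le_iSup₂ (f := fun t (_ : t ∈ Ioi (0 : ℝ)) =>
      (lnPhi φ t : EReal)) (2 * M) h2M)
    exact EReal.coe_lt_coe_iff.2 (hmono hM h2M (by linarith))
  · have h := lintegral_norm_pow_phiGaussian hp hc hd 0 hc0 (by rw [e0]; exact hI M hM)
    rw [e0, hcq] at h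
    simp only [pow_zero, ENNReal.ofReal_one, lintegral_one] at h
    rw [h, ENNReal.ofReal_eq_one]
    have : (∫⁻ x in Metric.ball (0 : Eucl d) 1, ENNReal.ofReal (‖x‖ ^ 0)).toReal = b 0 := rfl
    simp only [pow_zero, ENNReal.ofReal_one, lintegral_one] at this
    rw [this]
    have := hb0 0
    change (b 0 * J)⁻¹ * J * b 0 = 1
    field_simp
  · rw [lintegral_norm_pow_phiGaussian hp hc hd 2 hc0 (by rw [e2]; exact hI' M hM), e2, hcp, hMeq]
    congr 1
    have h0 := Real.rpow_pos_of_pos (hb0 0) (1 + 1 / q)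
    have h1 := Real.rpow_pos_of_pos hJ (1 + 1 / q)
    have h2 := hb0 2
    change _ * _ * b 2 = _
    generalize b 0 ^ (1 + 1 / q) = B at *
    generalize J ^ (1 + 1 / q) = J' at *
    field_simp

end

end

theorem proposition4p2 (d : ℕ) (hd : 2 ≤ d) (φ : ℝ → ℝ)
    (hφ : φ ∈ OrdClass (2 / ((d : ℝ) + 2))) :
    (∃ lam c : ℝ, IsStandardPair d φ lam c) ∧
    ∀ lam c : ℝ, IsStandardPair d φ lam c →
      (∀ (v : Eucl d) (V : Matrix (Fin d) (Fin d) ℝ), V.PosDef →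
        HasMeanCov (phiGaussian φ lam c v V) v V) ∧
      GeodesicallyConvex (phiGaussianSpace d φ lam c) ∧
      (∃ T : Measure (Eucl d) → Measure (Eucl d),
        BijOn T (gaussianSpace d) (phiGaussianSpace d φ lam c) ∧
        (∀ (v : Eucl d) (V : Matrix (Fin d) (Fin d) ℝ), V.PosDef →
          T (multivariateGaussian v V) = phiGaussian φ lam c v V) ∧
        ∀ μ ∈ gaussianSpace d, ∀ ν ∈ gaussianSpace d, W2 (T μ) (T ν) = W2 μ ν) ∧
      ∀ (v u : Eucl d) (V U : Matrix (Fin d) (Fin d) ℝ), V.PosDef → U.PosDef →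
        W2 (phiGaussian φ lam c v V) (phiGaussian φ lam c u U) ^ 2 = buresSq v u V U ∧
        W2 (multivariateGaussian v V) (multivariateGaussian u U) ^ 2 = buresSq v u V U ∧
        (∀ t ∈ Icc (0 : ℝ) 1, (covInterp V U t).PosDef) ∧
        IsGeodesic (fun t => phiGaussian φ lam c (meanInterp v u t) (covInterp V U t))
          (phiGaussian φ lam c v V) (phiGaussian φ lam c u U) ∧
        ∀ γ : ℝ → Measure (Eucl d),
          IsGeodesic γ (phiGaussian φ lam c v V) (phiGaussian φ lam c u U) →
          ∀ t ∈ Icc (0 : ℝ) 1,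
            γ t = phiGaussian φ lam c (meanInterp v u t) (covInterp V U t) :=
  ⟨exists_isStandardPair (by lia) hφ, fun _ _ h =>
    ⟨fun v _ hV => hasMeanCov_phiGaussian h v hV, geodesicallyConvex_phiGaussianSpace h,
      exists_gaussian_correspondence h, fun v u _ _ hV hU =>
      ⟨W2_sq_phiGaussian h v u hV hU, W2_sq_multivariateGaussian v u hV hU,
        fun _ ht => posDef_covInterp hV hU ht, isGeodesic_phiGaussian h v u hV hU,
        fun _ hγ _ ht => hγ.eq_phiGaussian h hV hU ht⟩⟩⟩
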